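/- Let $W$ be a standard one-dimensional Brownian motion on a probability space $(\Omega,\mathcal F,\mathbb P)$, let $(\mathcal F_s)_{s\ge 0}$ be its natural filtration augmented by the $\mathbb P$-null sets, and let $0\le t\le T<\infty$, $c^+\ge 0$, $x>0$ and $q>0$. Let $X$ be the continuous, adapted, square-integrable solution on $[t,T]$ of the stochastic differential equation $dX_r=X_r\,dW_r$, $X_t=x$. Let $\mathcal A$ be the set of progressively measurable, right-continuous, square-integrable processes $\pi=(\pi_r)_{r\in[0,T]}$ with values in $[0,c^+]$. For $\pi\in\mathcal A$ put $$Q^\pi_r=q-\int_t^r\pi_s\,ds,\qquad \tau^\pi=T\wedge\min\{r\ge t : Q^\pi_r=0\},\qquad J(\pi)=\mathbb E\Big[\int_t^{\tau^\pi}\pi_rX_r\,dr\Big],\qquad v(t,x,q)=\sup_{\pi\in\mathcal A}J(\pi)$$ (this is the optimal liquidation problem with running payoff $f(\pi,x)=\pi x$ and terminal payoff $g=0$). Let $c$ be the constant strategy $$c_r=\begin{cases}\dfrac{q}{T-t}&\text{if } q\le c^+(T-t),\\ c^+&\text{if } q>c^+(T-t).\end{cases}$$ Then $\int_t^{\tau^\pi}\pi_rX_r\,dr$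 is integrable for every $\pi\in\mathcal A$, the strategy $c$ is admissible and optimal, i.e. $c\in\mathcal A$ and $J(c)=\max_{\pi\in\mathcal A}J(\pi)$, and $$v(t,x,q)=J(c)=v^c(t,x,q):=\begin{cases}qx&\text{if } q\le c^+(T-t),\\ x\,c^+(T-t)&\text{if } q>c^+(T-t).\end{cases}$$ Moreover, if $q<c^+(T-t)$, then the optimal control $c$ violates the standard stochastic maximum principle (the one for the fixed terminal time $T$). Namely, let $$H(x,q,p,y,z)=-p\,y^Q+x\,z^X+p\,x,\qquad y=(y^X,y^Q),\ z=(z^X,z^Q),$$ be the Hamiltonian of the state $(X,Q)$ with $dX=X\,dW$, $dQ=-\pi\,dr$. Then the adjoint equations $-dY^X_r=\partial_xH\,dr-Z^X_r\,dW_r$, $-dY^Q_r=\partial_qH\,dr-Z^Q_r\,dW_r$ on $[t,T]$ with $Y^X_T=Y^Q_T=0$, evaluated along $c$, $X$ and $Q^c$, have a solution (with $Y$ continuous and adapted, and $Z$ progressively measurable and square-integrable), and for every solution and every $r\in[t,T]$, almost surely, the Hamiltonian condition $$H(X_r,Q^c_r,p,Y_r,Z_r)\le H(X_r,Q^c_r,c_r,Y_r,Z_r)\quad\text{for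 all }p\in[0,c^+]$$ fails. Likewise, for every $r\in[t,T]$, almost surely, the condition $f(p,X_r)\le f(c_r,X_r)$ for all $p\in[0,c^+]$ fails. -/

import Mathlib

open MeasureTheory ProbabilityTheory Set Filter Topology
open scoped NNReal ENNReal

noncomputable section

namespace Liquidation

/-! ### The filtration

Time is `ℝ≥0`.  Lebesgue integrals in time are taken over the real line, and a process is read at a
real time `s ≥ 0` as `s.toNNReal`. -/

/-- The filtration generated by the process `W`, augmented by all `P`-null sets. -/
def augFiltration {Ω : Type*} [mΩ : MeasurableSpace Ω] (P : Measure Ω) (W : ℝ≥0 → Ω → ℝ)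
    (hW : ∀ s, Measurable (W s)) : Filtration ℝ≥0 mΩ where
  seq r := (⨆ s ≤ r, MeasurableSpace.comap (W s) inferInstance) ⊔
    MeasurableSpace.generateFrom {N | MeasurableSet N ∧ P N = 0}
  mono' _ _ h := sup_le_sup_right (biSup_mono fun _ hs => le_trans hs h) _
  le' _ := sup_le (iSup₂_le fun s _ => (hW s).comap_le)
    (MeasurableSpace.generateFrom_le fun _ hN => hN.1)

variable {Ω : Type*} [mΩ : MeasurableSpace Ω]

/-- `∫_a^b g_s ds` for a function `g` of time. -/
def timeIntegral (a b : ℝ≥0) (g : ℝ≥0 → ℝ) : ℝ := ∫ s in (a : ℝ)..(b : ℝ), g s.toNNReal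

/-- `E ∫_a^b (φ_s)² ds`, as an extended nonnegative number. -/
def energy (P : Measure Ω) (a b : ℝ≥0) (φ : ℝ≥0 → Ω → ℝ) : ℝ≥0∞ :=
  ∫⁻ ω, (∫⁻ s in Icc (a : ℝ) (b : ℝ), ‖φ s.toNNReal ω‖ₑ ^ 2) ∂P

/-- Progressive measurability on the time interval `[0, T]`: for each `r ≤ T`, the map
`(s, ω) ↦ φ_s(ω)` on `[0, r] × Ω` is measurable for `Borel ⊗ F_r`. -/
def ProgressiveUpTo (F : Filtration ℝ≥0 mΩ) (T : ℝ≥0) (φ : ℝ≥0 → Ω → ℝ) : Prop :=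
  ∀ r ≤ T, StronglyMeasurable[Subtype.instMeasurableSpace.prod (F r)]
    fun p : Iic r × Ω => φ p.1 p.2

/-! ### The Itô integral -/

/-- Simple (elementary) processes `∑ ξ_i 1_{(t_i, t_{i+1}]}` with deterministic times and bounded
coefficients `ξ_i` measurable with respect to `F_{t_i}`. -/
structure SimpleProcess (F : Filtration ℝ≥0 mΩ) where
  /-- the number of intervals -/
  n : ℕ
  /-- the partition times -/
  time : ℕ → ℝ≥0
  time_mono : Monotone time
  /-- the coefficients -/
  coeff : ℕ → Ω → ℝ
  coeff_meas : ∀ i, StronglyMeasurable[F (time i)] (coeff i)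
  coeff_bdd : ∃ C : ℝ, ∀ i ω, |coeff i ω| ≤ C

/-- The process `∑ ξ_i 1_{(t_i, t_{i+1}]}`. -/
def SimpleProcess.value {F : Filtration ℝ≥0 mΩ} (Φ : SimpleProcess F) (s : ℝ≥0) (ω : Ω) : ℝ :=
  ∑ i ∈ Finset.range Φ.n, (Ioc (Φ.time i) (Φ.time (i + 1))).indicator (fun _ => Φ.coeff i ω) s

/-- The stochastic integral `∫_a^b Φ dW = ∑ ξ_i (W_{(t_{i+1} ∧ b) ∨ a} - W_{(t_i ∧ b) ∨ a})` of a
simple process, for `a ≤ b`. -/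
def SimpleProcess.integral {F : Filtration ℝ≥0 mΩ} (Φ : SimpleProcess F) (W : ℝ≥0 → Ω → ℝ)
    (a b : ℝ≥0) (ω : Ω) : ℝ :=
  ∑ i ∈ Finset.range Φ.n, Φ.coeff i ω *
    (W (max a (min (Φ.time (i + 1)) b)) ω - W (max a (min (Φ.time i) b)) ω)

/-- `I` is (a version of) the Itô integral `∫_a^b φ dW`: it is the `L²(P)`-limit of the integrals of
simple processes that converge to `φ` in `L²([a, b] × Ω)`. -/
def IsItoIntegral (P : Measure Ω) (F : Filtration ℝ≥0 mΩ) (W : ℝ≥0 → Ω → ℝ)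
    (φ : ℝ≥0 → Ω → ℝ) (a b : ℝ≥0) (I : Ω → ℝ) : Prop :=
  ∃ Φ : ℕ → SimpleProcess F,
    Tendsto (fun n => energy P a b fun s ω => (Φ n).value s ω - φ s ω) atTop (𝓝 0) ∧
    Tendsto (fun n => ∫⁻ ω, ‖(Φ n).integral W a b ω - I ω‖ₑ ^ 2 ∂P) atTop (𝓝 0)

/-- Continuous adapted processes on the time interval `[t, T]` (continuity almost surely). -/
structure IsContAdapted (P : Measure Ω) (F : Filtration ℝ≥0 mΩ) (t T : ℝ≥0)
    (X : ℝ≥0 → Ω → ℝ) : Prop where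
  adapted : ∀ r ∈ Icc t T, StronglyMeasurable[F r] (X r)
  cont : ∀ᵐ ω ∂P, ContinuousOn (fun r => X r ω) (Icc t T)

/-- `X` is a (strong, square-integrable) solution on `[t, T]` of the stochastic differential
equation `dX_r = X_r dW_r`, `X_t = x`, that is, `X_r = x + ∫_t^r X_s dW_s` for `r ∈ [t, T]`. -/
structure IsPriceProcess (P : Measure Ω) (F : Filtration ℝ≥0 mΩ) (W : ℝ≥0 → Ω → ℝ)
    (t T : ℝ≥0) (x : ℝ) (X : ℝ≥0 → Ω → ℝ) : Prop extends IsContAdapted P F t T X where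
  sq_integrable : energy P t T X < ∞
  eqn : ∀ r ∈ Icc t T, IsItoIntegral P F W X t r fun ω => X r ω - x

/-! ### The liquidation problem -/

/-- Admissible controls: progressively measurable, right-continuous, square-integrable processes
on `[0, T]` with values in `[0, cmax]`. -/
structure Admissible (P : Measure Ω) (F : Filtration ℝ≥0 mΩ) (T : ℝ≥0) (cmax : ℝ)
    (π : ℝ≥0 → Ω → ℝ) : Prop where
  progressive : ProgressiveUpTo F T π
  range : ∀ r ≤ T, ∀ ω, π r ω ∈ Icc 0 cmax
  right_cont : ∀ r < T, ∀ ω, ContinuousWithinAt (fun s => π s ω) (Ici r) r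
  sq_integrable : energy P 0 T π < ∞

/-- The inventory `Q^π_r = q - ∫_t^r π_s ds` at time `r ≥ t`, started from `Q_t = q`. -/
def inventory (t : ℝ≥0) (q : ℝ) (π : ℝ≥0 → Ω → ℝ) (r : ℝ≥0) (ω : Ω) : ℝ :=
  q - timeIntegral t r fun s => π s ω

/-- `τ^π = T ∧ min {r ≥ t | Q^π_r = 0}`, where the minimum of the empty set is `+∞`. -/
def liquidationTime (t T : ℝ≥0) (q : ℝ) (π : ℝ≥0 → Ω → ℝ) (ω : Ω) : ℝ≥0 :=
  sInf (insert T {r : ℝ≥0 | t ≤ r ∧ inventory t q π r ω = 0})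

/-- The running payoff `f(π, x) = π x`. -/
def runningPayoff (p x : ℝ) : ℝ := p * x

/-- The random payoff `∫_t^{τ^π} f(π_r, X_r) dr` (the terminal payoff `g` is zero). -/
def payoff (t T : ℝ≥0) (q : ℝ) (X π : ℝ≥0 → Ω → ℝ) (ω : Ω) : ℝ :=
  timeIntegral t (liquidationTime t T q π ω) fun s => runningPayoff (π s ω) (X s ω)

/-- The expected payoff of the control `π`. -/
def expectedPayoff (P : Measure Ω) (t T : ℝ≥0) (q : ℝ) (X π : ℝ≥0 → Ω → ℝ) : ℝ :=
  ∫ ω, payoff t T q X π ω ∂P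

/-- The value function: the supremum of the expected payoffs over all admissible controls. -/
def valueFunction (P : Measure Ω) (F : Filtration ℝ≥0 mΩ) (t T : ℝ≥0) (q cmax : ℝ)
    (X : ℝ≥0 → Ω → ℝ) : ℝ :=
  sSup (expectedPayoff P t T q X '' {π | Admissible P F T cmax π})

/-- The candidate rate: `q / (T - t)` if `q ≤ cmax (T - t)`, and `cmax` otherwise. -/
def candidateRate (t T q cmax : ℝ) : ℝ :=
  if q ≤ cmax * (T - t) then q / (T - t) else cmax

/-- The candidate value: `q x` if `q ≤ cmax (T - t)`, and `x cmax (T - t)` otherwise. -/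
def candidateValue (t T x q cmax : ℝ) : ℝ :=
  if q ≤ cmax * (T - t) then q * x else x * cmax * (T - t)

/-! ### The standard stochastic maximum principle (fixed terminal time)

The controlled state is `(X, Q)` with `dX = X dW`, `dQ = -π dr`, running payoff `π X` and no terminal
payoff. -/

/-- The Hamiltonian `b · y + σ · z + f` of the state `(X, Q)`, with drift `b = (0, -p)`,
volatility `σ = (x, 0)`, adjoint variables `y = (yX, yQ)`, `z = (zX, zQ)`. It does not depend on
the inventory level `q`. -/
def stdHamiltonian (x _q p yX yQ zX zQ : ℝ) : ℝ :=
  (0 * yX + (-p) * yQ) + (x * zX + 0 * zQ) + runningPayoff p x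

/-- `(Y, Z)` solves on `[t, T]` the backward equation `-dY_r = h_r dr - Z_r dW_r`, `Y_T = 0`, that is,
`∫_r^T Z_s dW_s = ∫_r^T h_s ds - Y_r` for all `r ∈ [t, T]`. -/
structure IsBSDESolution (P : Measure Ω) (F : Filtration ℝ≥0 mΩ) (W : ℝ≥0 → Ω → ℝ)
    (t T : ℝ≥0) (h Y Z : ℝ≥0 → Ω → ℝ) : Prop extends IsContAdapted P F t T Y where
  progressive : ProgressiveUpTo F T Z
  sq_integrable : energy P t T Z < ∞
  eqn : ∀ r ∈ Icc t T, IsItoIntegral P F W Z r T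
    fun ω => (timeIntegral r T fun s => h s ω) - Y r ω

/-- The adjoint equations of the standard maximum principle along the control `c`: the drivers are
the derivatives of the Hamiltonian with respect to the two state variables. -/
structure IsStdAdjoint (P : Measure Ω) (F : Filtration ℝ≥0 mΩ) (W : ℝ≥0 → Ω → ℝ)
    (t T : ℝ≥0) (q : ℝ) (X c YX YQ ZX ZQ : ℝ≥0 → Ω → ℝ) : Prop where
  price : IsBSDESolution P F W t T (fun s ω => deriv (fun y => stdHamiltonian y
    (inventory t q c s ω) (c s ω) (YX s ω) (YQ s ω) (ZX s ω) (ZQ s ω)) (X s ω)) YX ZX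
  stock : IsBSDESolution P F W t T (fun s ω => deriv (fun y => stdHamiltonian (X s ω)
    y (c s ω) (YX s ω) (YQ s ω) (ZX s ω) (ZQ s ω)) (inventory t q c s ω)) YQ ZQ

/-- The Hamiltonian condition of the standard maximum principle at time `r` and scenario `ω`:
`c_r(ω)` maximizes the Hamiltonian over `[0, cmax]`. -/
def StdMaximumCondition (t : ℝ≥0) (q cmax : ℝ) (X c YX YQ ZX ZQ : ℝ≥0 → Ω → ℝ) (r : ℝ≥0)
    (ω : Ω) : Prop :=
  ∀ p ∈ Icc 0 cmax,
    stdHamiltonian (X r ω) (inventory t q c r ω) p (YX r ω) (YQ r ω) (ZX r ω) (ZQ r ω) ≤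
    stdHamiltonian (X r ω) (inventory t q c r ω) (c r ω) (YX r ω) (YQ r ω) (ZX r ω) (ZQ r ω)

end Liquidation

end

open Liquidation

/-! The price is a positive martingale, so when something is sold does not matter in expectation,
only how much. Let `ψ_s` be the control `π_s` switched off once the inventory is exhausted; it is
`F_s`-measurable and bounded. Fubini's theorem and `E[ψ_s X_s] = E[ψ_s X_T]` give `J(π) = E[A X_T]`,
where `A = ∫ ψ_s ds` is the amount sold (`expectedPayoff_eq`). On every path `A ≤ min(q, cmax (T -
t))`. Since `X_T > 0` almost surely and `E X_T = x`, this bounds every payoff by `candidateValue`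
(`expectedPayoff_le`). The candidate sells exactly the maximal amount, so it attains the bound.

The martingale property comes from `L²` theory: elementary integrals satisfy a polarised isometry,
and an integral over times after `s` is orthogonal to `F_s`; both pass to limits (`IsItoLimit`).
Positivity is obtained by identifying `X_r` with `x exp(W_r - W_t - (r - t)/2)` without Itô's
formula. Over a step of length `δ ≤ 1`, the mean square of the difference between the two grows at
most by a factor `1 + 3δ` plus an error of order `δ²`, so a discrete Gronwall argument forces it to
vanish (`ae_eq_stochExp`).

For the maximum principle, the Hamiltonian does not depend on the inventory, so `Y^Q` has zero
driver and vanishes almost surely. The Hamiltonian is then affine in `p` with slope `X_r > 0`, so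
its only maximiser is `cmax`, whereas the optimal rate is strictly smaller when `q < cmax (T - t)`.
-/

namespace Liquidation

/-! ### Brownian increments and the augmented filtration -/

section Increments

variable {Ω : Type*} [mΩ : MeasurableSpace Ω] {P : Measure Ω}
  {W : ℝ≥0 → Ω → ℝ} {hW : ∀ s, Measurable (W s)}

lemma measurable_augFiltration {r s : ℝ≥0} (h : s ≤ r) :
    Measurable[augFiltration P W hW r] (W s) := by
  have : MeasurableSpace.comap (W s) inferInstance ≤ augFiltration P W hW r :=
    le_trans (le_iSup₂_of_le (f := fun s (_ : s ≤ r) => MeasurableSpace.comap (W s) inferInstance)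
      s h le_rfl) le_sup_left
  exact (comap_measurable (W s)).mono this le_rfl

lemma measurableSet_augFiltration_of_null {N : Set Ω} (hN : MeasurableSet N) (h0 : P N = 0)
    (r : ℝ≥0) : MeasurableSet[augFiltration P W hW r] N := by
  have : MeasurableSpace.generateFrom {N | MeasurableSet N ∧ P N = 0} ≤ augFiltration P W hW r :=
    le_sup_right
  exact this _ (MeasurableSpace.measurableSet_generateFrom ⟨hN, h0⟩)

/-- The sets almost surely equal to an event of the raw filtration form a σ-algebra, and null sets
belong to it because they are almost surely empty. Independence can therefore be checked on the raw
filtration. -/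
lemma augFiltration_le_eventuallyMeasurableSpace (r : ℝ≥0) :
    augFiltration P W hW r ≤
      eventuallyMeasurableSpace (⨆ s ≤ r, MeasurableSpace.comap (W s) inferInstance) (ae P) := by
  refine sup_le le_eventuallyMeasurableSpace (MeasurableSpace.generateFrom_le ?_)
  rintro N ⟨-, h0⟩
  exact ⟨∅, @MeasurableSet.empty Ω (⨆ s ≤ r, MeasurableSpace.comap (W s) inferInstance), ae_eq_empty.2 h0⟩

lemma hasLaw_increment (hB : IsPreBrownianReal W P) {u v : ℝ≥0} (huv : u ≤ v) :
    HasLaw (fun ω => W v ω - W u ω) (gaussianReal 0 (v - u)) P := by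
  have h := hB.hasLaw_sub v u
  have : nndist v.1 u.1 = v - u := by
    ext
    rw [coe_nndist, Real.dist_eq, NNReal.coe_sub huv]
    exact abs_of_nonneg (sub_nonneg.2 (NNReal.coe_le_coe.2 huv))
  rwa [this] at h

lemma stronglyMeasurable_of_augFiltration {r : ℝ≥0} {ξ : Ω → ℝ}
    (hξ : StronglyMeasurable[augFiltration P W hW r] ξ) : StronglyMeasurable ξ :=
  hξ.mono ((augFiltration P W hW).le r)

/-- Multiplying by a function of an independent increment preserves square-integrability. -/
lemma memLp_mul_of_indepFun {ξ η : Ω → ℝ} (h : IndepFun ξ η P) (hξ : MemLp ξ 2 P)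
    (hη : MemLp η 2 P) : MemLp (fun ω => ξ ω * η ω) 2 P := by
  have h2 : IndepFun (fun ω => ξ ω ^ 2) (fun ω => η ω ^ 2) P :=
    h.comp (φ := fun y : ℝ => y ^ 2) (ψ := fun y : ℝ => y ^ 2) (by fun_prop) (by fun_prop)
  refine (memLp_two_iff_integrable_sq (hξ.1.mul hη.1)).2 ?_
  refine (h2.integrable_mul hξ.integrable_sq hη.integrable_sq).congr (ae_of_all _ fun ω => ?_)
  simp [mul_pow]

lemma integral_mul_sq_of_indepFun {ξ η : Ω → ℝ} (h : IndepFun ξ η P) (hξ : MemLp ξ 2 P)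
    (hη : MemLp η 2 P) :
    ∫ ω, (ξ ω * η ω) ^ 2 ∂P = (∫ ω, ξ ω ^ 2 ∂P) * ∫ ω, η ω ^ 2 ∂P := by
  have h2 : IndepFun (fun ω => ξ ω ^ 2) (fun ω => η ω ^ 2) P :=
    h.comp (φ := fun y : ℝ => y ^ 2) (ψ := fun y : ℝ => y ^ 2) (by fun_prop) (by fun_prop)
  rw [← h2.integral_fun_mul_eq_mul_integral (hξ.1.pow 2) (hη.1.pow 2)]
  simp [mul_pow]

lemma stronglyMeasurable_mul_increment {u v r : ℝ≥0} (huv : u ≤ v) (hvr : v ≤ r) {ξ : Ω → ℝ}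
    (hξ : StronglyMeasurable[augFiltration P W hW u] ξ) :
    StronglyMeasurable[augFiltration P W hW r] (fun ω => ξ ω * (W v ω - W u ω)) :=
  (hξ.mono ((augFiltration P W hW).mono (huv.trans hvr))).mul
    ((measurable_augFiltration hvr).sub
      (measurable_augFiltration (huv.trans hvr))).stronglyMeasurable

lemma memLp_increment (hB : IsPreBrownianReal W P) {u v : ℝ≥0} (huv : u ≤ v) :
    MemLp (fun ω => W v ω - W u ω) 2 P :=
  (hasLaw_increment hB huv).hasGaussianLaw.memLp_two

lemma integral_increment (hB : IsPreBrownianReal W P) {u v : ℝ≥0} (huv : u ≤ v) :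
    ∫ ω, (W v ω - W u ω) ∂P = 0 := by
  rw [(hasLaw_increment hB huv).integral_eq, integral_id_gaussianReal]

lemma integrable_fun_mul {ξ η : Ω → ℝ} (hξ : MemLp ξ 2 P) (hη : MemLp η 2 P) :
    Integrable (fun ω => ξ ω * η ω) P :=
  hξ.integrable_mul hη

/-- The increment is the coordinate at time `v - u` of the process shifted by `u`, which is
independent of the raw past. Replacing an event of the augmented past by an almost surely equal raw
one changes no probability. -/
lemma indepFun_increment (hB : IsPreBrownianReal W P) {u v : ℝ≥0} (huv : u ≤ v) {ξ : Ω → ℝ}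
    (hξ : StronglyMeasurable[augFiltration P W hW u] ξ) :
    IndepFun ξ (fun ω => W v ω - W u ω) P := by
  have h1 : Indep (⨆ s ≤ u, MeasurableSpace.comap (W s) inferInstance)
      (MeasurableSpace.comap (fun ω => W v ω - W u ω) inferInstance) P := by
    have hφ : Measurable fun f : ℝ≥0 → ℝ => f (v - u) := measurable_pi_apply _
    have h := (hB.indepFun_shift u).comp hφ measurable_id
    have h2 := h.symm
    rw [IndepFun_iff_Indep] at h2
    have e : ((fun f : ℝ≥0 → ℝ => f (v - u)) ∘ fun ω t => W (u + t) ω - W u ω)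
        = fun ω => W v ω - W u ω := by
      ext ω
      simp [add_tsub_cancel_of_le huv]
    rw [e] at h2
    refine indep_of_indep_of_le_left h2 (iSup₂_le fun s hs => ?_)
    have : W s = (fun f : Iic u → ℝ => f ⟨s, hs⟩) ∘ (id ∘ fun ω (t : Iic u) => W t ω) := rfl
    rw [this, ← MeasurableSpace.comap_comp]
    exact MeasurableSpace.comap_mono (measurable_pi_apply _).comap_le
  rw [IndepFun_iff_Indep, Indep_iff]
  rw [Indep_iff] at h1
  intro A C hA hC
  obtain ⟨B, hBm, hAB⟩ := augFiltration_le_eventuallyMeasurableSpace (hW := hW) u A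
    (hξ.measurable.comap_le A hA)
  rw [measure_congr hAB, ← h1 B C hBm hC]
  exact measure_congr (hAB.inter (ae_eq_refl C))

lemma integral_increment_sq (hB : IsPreBrownianReal W P) {u v : ℝ≥0} (huv : u ≤ v) :
    ∫ ω, (W v ω - W u ω) ^ 2 ∂P = (v : ℝ) - u := by
  have h := (hasLaw_increment hB huv).variance_eq
  rw [variance_of_integral_eq_zero (hasLaw_increment hB huv).aemeasurable
    (integral_increment hB huv)] at h
  rw [h]
  simp [NNReal.coe_sub huv]

lemma memLp_mul_increment (hB : IsPreBrownianReal W P) {u v : ℝ≥0} (huv : u ≤ v) {ξ : Ω → ℝ}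
    (hξ : StronglyMeasurable[augFiltration P W hW u] ξ) (h2 : MemLp ξ 2 P) :
    MemLp (fun ω => ξ ω * (W v ω - W u ω)) 2 P :=
  memLp_mul_of_indepFun (indepFun_increment hB huv hξ) h2 (memLp_increment hB huv)

lemma integral_mul_increment (hB : IsPreBrownianReal W P) {u v : ℝ≥0} (huv : u ≤ v) {ξ : Ω → ℝ}
    (hξ : StronglyMeasurable[augFiltration P W hW u] ξ) :
    ∫ ω, ξ ω * (W v ω - W u ω) ∂P = 0 := by
  rw [(indepFun_increment hB huv hξ).integral_fun_mul_eq_mul_integral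
    (stronglyMeasurable_of_augFiltration hξ).aestronglyMeasurable (memLp_increment hB huv).1,
    integral_increment hB huv, mul_zero]

lemma integral_mul_increment_sq (hB : IsPreBrownianReal W P) {u v : ℝ≥0} (huv : u ≤ v) {ξ : Ω → ℝ}
    (hξ : StronglyMeasurable[augFiltration P W hW u] ξ) :
    ∫ ω, ξ ω * (W v ω - W u ω) ^ 2 ∂P = (∫ ω, ξ ω ∂P) * ((v : ℝ) - u) := by
  have h := (indepFun_increment hB huv hξ).comp (φ := id) (ψ := fun y : ℝ => y ^ 2)
    measurable_id (by fun_prop)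
  have := h.integral_fun_mul_eq_mul_integral
    (stronglyMeasurable_of_augFiltration hξ).aestronglyMeasurable ((memLp_increment hB huv).1.pow 2)
  simp only [Function.comp_def, id] at this
  rw [← integral_increment_sq hB huv, ← this]

/-- Elementary integrals over consecutive intervals are orthogonal. -/
lemma integral_elementary_mul_of_le (hB : IsPreBrownianReal W P) {u v u' v' : ℝ≥0} (huv : u ≤ v)
    (hvu : v ≤ u') (huv' : u' ≤ v') {ξ η : Ω → ℝ}
    (hξ : StronglyMeasurable[augFiltration P W hW u] ξ)
    (hη : StronglyMeasurable[augFiltration P W hW u'] η) :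
    ∫ ω, (ξ ω * (W v ω - W u ω)) * (η ω * (W v' ω - W u' ω)) ∂P = 0 := by
  rw [← integral_mul_increment hB huv' ((stronglyMeasurable_mul_increment huv hvu hξ).mul hη)]
  exact integral_congr_ae (ae_of_all _ fun ω => by simp only [Pi.mul_apply]; ring)

/-- Covariance of two elementary integrals. -/
lemma integral_elementary_mul_aux (hB : IsPreBrownianReal W P) {u v u' v' : ℝ≥0} (huv : u ≤ v)
    (huu : u ≤ u') (huv' : u' ≤ v') {ξ η : Ω → ℝ}
    (hξ : StronglyMeasurable[augFiltration P W hW u] ξ) (hξ2 : MemLp ξ 2 P)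
    (hη : StronglyMeasurable[augFiltration P W hW u'] η) (hη2 : MemLp η 2 P) :
    ∫ ω, (ξ ω * (W v ω - W u ω)) * (η ω * (W v' ω - W u' ω)) ∂P
      = (∫ ω, ξ ω * η ω ∂P) * volume.real (Ioc (u : ℝ) v ∩ Ioc (u' : ℝ) v') := by
  rw [Ioc_inter_Ioc, Real.volume_real_Ioc, max_eq_right (NNReal.coe_le_coe.2 huu)]
  rcases le_total v u' with h | h
  · rw [integral_elementary_mul_of_le hB huv h huv' hξ hη, max_eq_right, mul_zero]
    have : (v : ℝ) ≤ u' := h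
    have := min_le_left (v : ℝ) v'
    linarith
  have hmono {a b : ℝ≥0} (hab : a ≤ b) := (augFiltration P W hW).mono hab
  have hξ' := hξ.mono (hmono huu)
  have i1 := memLp_mul_increment hB huu hξ hξ2
  rcases le_total v v' with h' | h'
  · have i2 := memLp_mul_increment hB h hξ' hξ2
    have i3 := memLp_mul_increment hB h hη hη2
    have i4 := memLp_mul_increment hB h' (hη.mono (hmono h)) hη2
    have i5 := memLp_mul_increment hB huv' hη hη2
    rw [min_eq_left (NNReal.coe_le_coe.2 h'), max_eq_left (sub_nonneg.2 (NNReal.coe_le_coe.2 h)),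
      ← show _ = (∫ ω, ξ ω * η ω ∂P) * _ from integral_mul_increment_sq hB h (hξ'.mul hη)]
    -- Both increments are split at the ends of the overlap. The overlap contributes the squared
    -- increment; the other two products belong to consecutive intervals and have mean zero.
    have e : ∀ ω, (ξ ω * (W v ω - W u ω)) * (η ω * (W v' ω - W u' ω))
        = (ξ ω * (W u' ω - W u ω)) * (η ω * (W v' ω - W u' ω))
        + (ξ ω * η ω * (W v ω - W u' ω) ^ 2
        + (ξ ω * (W v ω - W u' ω)) * (η ω * (W v' ω - W v ω))) := fun ω => by ring
    -- The product `ξ η` is only integrable, so the squared term is read as a product of two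
    -- square-integrable elementary integrals.
    have j : Integrable (fun ω => ξ ω * η ω * (W v ω - W u' ω) ^ 2) P :=
      (integrable_fun_mul i2 i3).congr (ae_of_all _ fun ω => by ring)
    simp_rw [e]
    rw [integral_add (integrable_fun_mul i1 i5) (j.fun_add (integrable_fun_mul i2 i4)),
      integral_add j (integrable_fun_mul i2 i4),
      integral_elementary_mul_of_le hB huu le_rfl huv' hξ hη,
      integral_elementary_mul_of_le hB h le_rfl h' hξ' (hη.mono (hmono h))]
    simp
  · have i2 := memLp_mul_increment hB huv' hξ' hξ2
    have i3 := memLp_mul_increment hB h' (hξ'.mono (hmono huv')) hξ2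
    have i5 := memLp_mul_increment hB huv' hη hη2
    rw [min_eq_right (NNReal.coe_le_coe.2 h'),
      max_eq_left (sub_nonneg.2 (NNReal.coe_le_coe.2 huv')),
      ← show _ = (∫ ω, ξ ω * η ω ∂P) * _ from integral_mul_increment_sq hB huv' (hξ'.mul hη)]
    have e : ∀ ω, (ξ ω * (W v ω - W u ω)) * (η ω * (W v' ω - W u' ω))
        = (ξ ω * (W u' ω - W u ω)) * (η ω * (W v' ω - W u' ω))
        + (ξ ω * η ω * (W v' ω - W u' ω) ^ 2
        + (η ω * (W v' ω - W u' ω)) * (ξ ω * (W v ω - W v' ω))) := fun ω => by ring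
    have j : Integrable (fun ω => ξ ω * η ω * (W v' ω - W u' ω) ^ 2) P :=
      (integrable_fun_mul i2 i5).congr (ae_of_all _ fun ω => by ring)
    simp_rw [e]
    rw [integral_add (integrable_fun_mul i1 i5) (j.fun_add (integrable_fun_mul i5 i3)),
      integral_add j (integrable_fun_mul i5 i3),
      integral_elementary_mul_of_le hB huu le_rfl huv' hξ hη,
      integral_elementary_mul_of_le hB huv' le_rfl h' hη (hξ'.mono (hmono huv'))]
    simp

lemma integral_elementary_mul (hB : IsPreBrownianReal W P) {u v u' v' : ℝ≥0} (huv : u ≤ v)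
    (huv' : u' ≤ v') {ξ η : Ω → ℝ}
    (hξ : StronglyMeasurable[augFiltration P W hW u] ξ) (hξ2 : MemLp ξ 2 P)
    (hη : StronglyMeasurable[augFiltration P W hW u'] η) (hη2 : MemLp η 2 P) :
    ∫ ω, (ξ ω * (W v ω - W u ω)) * (η ω * (W v' ω - W u' ω)) ∂P
      = (∫ ω, ξ ω * η ω ∂P) * volume.real (Ioc (u : ℝ) v ∩ Ioc (u' : ℝ) v') := by
  rcases le_total u u' with h | h
  · exact integral_elementary_mul_aux hB huv h huv' hξ hξ2 hη hη2
  · have := integral_elementary_mul_aux hB huv' h huv hη hη2 hξ hξ2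
    simp_rw [mul_comm (η _) (ξ _), inter_comm (Ioc (u' : ℝ) v')] at this
    rw [← this]
    simp_rw [mul_comm]

end Increments

/-! ### The exponential of a Gaussian increment -/

section GaussianExp

variable {v : ℝ≥0}

lemma memLp_exp_gaussianReal (a : ℝ) :
    MemLp (fun y : ℝ => Real.exp (y + a)) 2 (gaussianReal 0 v) := by
  rw [memLp_two_iff_integrable_sq (by fun_prop)]
  refine ((integrable_exp_mul_gaussianReal (μ := 0) (v := v) 2).mul_const
    (Real.exp (2 * a))).congr (ae_of_all _ fun y => ?_)
  simp only [← Real.exp_add, ← Real.exp_nat_mul]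
  congr 1
  push_cast
  ring

lemma integral_exp_gaussianReal (b a : ℝ) :
    ∫ y, Real.exp (b * y + a) ∂(gaussianReal 0 v) = Real.exp (v * b ^ 2 / 2 + a) := by
  have h := congrFun (mgf_fun_id_gaussianReal (μ := 0) (v := v)) b
  simp only [mgf] at h
  simp_rw [Real.exp_add _ a, integral_mul_const, h]
  simp

/-- This is the derivative at `1` of the moment generating function `exp(v t² / 2)`. -/
lemma integral_mul_exp_gaussianReal (a : ℝ) :
    ∫ y, y * Real.exp (y + a) ∂(gaussianReal 0 v) = v * Real.exp (v / 2 + a) := by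
  have h := deriv_mgf (X := fun y : ℝ => y) (μ := gaussianReal 0 v) (t := 1) (by simp)
  rw [mgf_fun_id_gaussianReal] at h
  have hd : HasDerivAt (fun t : ℝ => Real.exp (0 * t + v * t ^ 2 / 2)) (v * Real.exp (v / 2)) 1 := by
    have h1 : HasDerivAt (fun t : ℝ => 0 * t + v * t ^ 2 / 2) (v : ℝ) 1 := by
      have := (((hasDerivAt_pow 2 (1 : ℝ)).const_mul (v : ℝ)).div_const 2).const_add 0
      simpa using this
    have := h1.exp
    simpa [mul_comm] using this
  rw [hd.deriv] at h
  simp_rw [Real.exp_add _ a, ← mul_assoc, integral_mul_const, h]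
  simp

/-- The remainder of the first-order expansion of the normalised exponential. -/
noncomputable def expRemainder (δ y : ℝ) : ℝ := Real.exp (y - δ / 2) - 1 - y

lemma memLp_expRemainder : MemLp (expRemainder v) 2 (gaussianReal 0 v) := by
  have h1 := memLp_exp_gaussianReal (v := v) (-(v / 2 : ℝ))
  exact (h1.sub (memLp_const 1)).sub (memLp_id_gaussianReal' 2 (by simp))

lemma integral_expRemainder : ∫ y, expRemainder v y ∂(gaussianReal 0 v) = 0 := by
  have h1 := (memLp_exp_gaussianReal (v := v) (-(v / 2 : ℝ))).integrable (by norm_num)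
  have h2 : Integrable (fun y : ℝ => y) (gaussianReal 0 v) :=
    (memLp_id_gaussianReal' 1 (by simp)).integrable le_rfl
  have h3 := integral_exp_gaussianReal (v := v) 1 (-(v / 2 : ℝ))
  simp only [expRemainder, sub_eq_add_neg _ ((v : ℝ) / 2)]
  rw [integral_sub (f := fun y : ℝ => Real.exp (y + -(v / 2 : ℝ)) - 1) (h1.sub (integrable_const 1)) h2,
    integral_sub h1 (integrable_const 1)]
  simp only [one_mul] at h3
  rw [h3]
  simp

/-- Expanding the square gives exactly `e^v - 1 - v`, which is at most `v²` for `v ≤ 1`. -/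
lemma integral_expRemainder_sq_le (hv : v ≤ 1) :
    ∫ y, expRemainder v y ^ 2 ∂(gaussianReal 0 v) ≤ (v : ℝ) ^ 2 := by
  have m1 := memLp_exp_gaussianReal (v := v) (-(v / 2 : ℝ))
  have m2 : MemLp (fun y : ℝ => y) 2 (gaussianReal 0 v) := memLp_id_gaussianReal' 2 (by simp)
  have h1 := m1.integrable (by norm_num)
  have h2 : Integrable (fun y : ℝ => y) (gaussianReal 0 v) := m2.integrable (by norm_num)
  have h3 : Integrable (fun y : ℝ => y * Real.exp (y + -(v / 2 : ℝ))) (gaussianReal 0 v) :=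
    m2.integrable_mul m1
  have e1 := integral_exp_gaussianReal (v := v) 1 (-(v / 2 : ℝ))
  have e2 := integral_exp_gaussianReal (v := v) 2 (-(v : ℝ))
  have e3 := integral_mul_exp_gaussianReal (v := v) (-(v / 2 : ℝ))
  have e4 : ∫ y, y ^ 2 ∂(gaussianReal 0 v) = v := by
    have h := variance_fun_id_gaussianReal (μ := 0) (v := v)
    rwa [variance_of_integral_eq_zero measurable_id'.aemeasurable integral_id_gaussianReal] at h
  have h4 : Integrable (fun y : ℝ => Real.exp (2 * y + -(v : ℝ))) (gaussianReal 0 v) :=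
    m1.integrable_sq.congr (ae_of_all _ fun y => by
      simp only [← Real.exp_nat_mul]; congr 1; push_cast; ring)
  have key : ∀ y : ℝ, expRemainder v y ^ 2 = Real.exp (2 * y + -(v : ℝ)) + y ^ 2 + 1
      - 2 * Real.exp (1 * y + -(v / 2 : ℝ)) - 2 * (y * Real.exp (y + -(v / 2 : ℝ))) + 2 * y := by
    intro y
    have : Real.exp (2 * y + -(v : ℝ)) = Real.exp (y + -(v / 2 : ℝ)) ^ 2 := by
      rw [← Real.exp_nat_mul]; congr 1; push_cast; ring
    rw [this, expRemainder, one_mul, sub_eq_add_neg y]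
    ring
  have h1' : Integrable (fun y : ℝ => Real.exp (1 * y + -(v / 2 : ℝ))) (gaussianReal 0 v) := by
    simpa only [one_mul] using h1
  simp_rw [key]
  rw [integral_add _ (h2.const_mul 2), integral_sub _ (h3.const_mul 2),
    integral_sub _ (h1'.const_mul 2), integral_add _ (integrable_const 1),
    integral_add h4 m2.integrable_sq, integral_const_mul, integral_const_mul, integral_const_mul,
    e1, e2, e3, e4, integral_id_gaussianReal]
  · have := Real.abs_exp_sub_one_sub_id_le (x := v) (by
      rw [abs_of_nonneg v.coe_nonneg]; exact_mod_cast hv)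
    have := (abs_le.1 this).2
    simp only [integral_const, probReal_univ, smul_eq_mul, mul_one, mul_zero, add_zero]
    have a1 : (v : ℝ) * 2 ^ 2 / 2 + -(v : ℝ) = v := by ring
    have a2 : (v : ℝ) * 1 ^ 2 / 2 + -((v : ℝ) / 2) = 0 := by ring
    have a3 : (v : ℝ) / 2 + -((v : ℝ) / 2) = 0 := by ring
    rw [a1, a2, a3, Real.exp_zero]
    linarith
  · exact h4.add m2.integrable_sq
  · exact (h4.add m2.integrable_sq).add (integrable_const 1)
  · exact ((h4.add m2.integrable_sq).add (integrable_const 1)).sub (h1'.const_mul 2)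
  · exact (((h4.add m2.integrable_sq).add (integrable_const 1)).sub (h1'.const_mul 2)).sub
      (h3.const_mul 2)

end GaussianExp

/-! ### Square norms and `L²`-limits -/

section L2

variable {α : Type*} {m : MeasurableSpace α} {μ : Measure α} {f g : α → ℝ}

lemma eLpNorm_two_sq (f : α → ℝ) (μ : Measure α) :
    eLpNorm f 2 μ ^ 2 = ∫⁻ a, ‖f a‖ₑ ^ 2 ∂μ := by
  have := eLpNorm_nnreal_pow_eq_lintegral (f := f) (μ := μ) (p := 2) (by norm_num)
  simpa using this

lemma integral_sq_eq_toReal (hf : AEStronglyMeasurable f μ) :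
    ∫ a, f a ^ 2 ∂μ = (eLpNorm f 2 μ ^ 2).toReal := by
  rw [eLpNorm_two_sq, integral_eq_lintegral_of_nonneg_ae (ae_of_all _ fun a => sq_nonneg _)
    (hf.pow 2)]
  congr 1
  refine lintegral_congr fun a => ?_
  rw [Real.enorm_eq_ofReal_abs, ← ENNReal.ofReal_pow (abs_nonneg _), sq_abs]

/-- The two functions live on different spaces because the isometry compares `Ω` with time times
`Ω`. -/
lemma eLpNorm_eq_of_integral_sq_eq {β : Type*} {m' : MeasurableSpace β} {ν : Measure β} {h : β → ℝ}
    (hf : MemLp f 2 μ) (hh : MemLp h 2 ν) (e : ∫ a, f a ^ 2 ∂μ = ∫ b, h b ^ 2 ∂ν) :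
    eLpNorm f 2 μ = eLpNorm h 2 ν := by
  rw [integral_sq_eq_toReal hf.1, integral_sq_eq_toReal hh.1, ENNReal.toReal_eq_toReal_iff'
    (ENNReal.pow_ne_top hf.2.ne) (ENNReal.pow_ne_top hh.2.ne)] at e
  exact (ENNReal.pow_right_strictMono two_ne_zero).injective e

/-- Inner products with a fixed square-integrable function pass to `L²`-limits. -/
lemma tendsto_integral_mul {F : ℕ → α → ℝ} (hg : MemLp g 2 μ) (hF : ∀ n, MemLp (F n) 2 μ)
    (hf : MemLp f 2 μ) (h : Tendsto (fun n => eLpNorm (F n - f) 2 μ) atTop (𝓝 0)) :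
    Tendsto (fun n => ∫ a, g a * F n a ∂μ) atTop (𝓝 (∫ a, g a * f a ∂μ)) := by
  refine tendsto_integral_of_L1' _ (hg.integrable_mul hf).1 (Eventually.of_forall fun n =>
    hg.integrable_mul (hF n)) ?_
  have hb : ∀ n, eLpNorm ((fun a => g a * F n a) - fun a => g a * f a) 1 μ
      ≤ eLpNorm g 2 μ * eLpNorm (F n - f) 2 μ := fun n => by
    have := eLpNorm_smul_le_mul_eLpNorm (p := 2) (q := 2) (r := 1) ((hF n).sub hf).1 hg.1
    refine le_of_eq_of_le ?_ this
    congr 1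
    ext a
    simp only [Pi.sub_apply, Pi.smul_apply', smul_eq_mul, mul_sub]
  have hz : Tendsto (fun n => eLpNorm g 2 μ * eLpNorm (F n - f) 2 μ) atTop (𝓝 0) := by
    simpa using ENNReal.Tendsto.const_mul h (Or.inr hg.2.ne)
  exact tendsto_of_tendsto_of_tendsto_of_le_of_le tendsto_const_nhds hz (fun _ => zero_le) hb

end L2

/-! ### Elementary processes with square-integrable coefficients and their limits -/

section Elementary

variable {Ω : Type*}

/-- The process `ξ 1_{(u, v]}`, as a function of time and scenario. -/
noncomputable def stepProcess (u v : ℝ≥0) (ξ : Ω → ℝ) (p : ℝ × Ω) : ℝ :=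
  (Ioc (u : ℝ) v).indicator (fun _ => ξ p.2) p.1

lemma stepProcess_eq_mul (u v : ℝ≥0) (ξ : Ω → ℝ) (p : ℝ × Ω) :
    stepProcess u v ξ p = (Ioc (u : ℝ) v).indicator 1 p.1 * ξ p.2 := by
  by_cases h : p.1 ∈ Ioc (u : ℝ) v <;> simp [stepProcess, h]

variable [mΩ : MeasurableSpace Ω]

/-- `φ = ∑ ξ_i 1_{(u_i, v_i]}` is an elementary process with square-integrable coefficients, and
`I = ∑ ξ_i (W_{v_i} - W_{u_i})` is its integral. -/
inductive IsElementary (P : Measure Ω) (W : ℝ≥0 → Ω → ℝ) (hW : ∀ s, Measurable (W s)) :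
    (ℝ × Ω → ℝ) → (Ω → ℝ) → Prop
  | zero : IsElementary P W hW 0 0
  | add_step {φ : ℝ × Ω → ℝ} {I : Ω → ℝ} {u v : ℝ≥0} {ξ : Ω → ℝ} (h : IsElementary P W hW φ I)
      (huv : u ≤ v) (hξ : StronglyMeasurable[augFiltration P W hW u] ξ) (hξ2 : MemLp ξ 2 P) :
      IsElementary P W hW (φ + stepProcess u v ξ) (I + fun ω => ξ ω * (W v ω - W u ω))

variable {P : Measure Ω} {W : ℝ≥0 → Ω → ℝ} {hW : ∀ s, Measurable (W s)}

lemma memLp_stepProcess [SFinite P] {u v : ℝ≥0} {ξ : Ω → ℝ} (hξ2 : MemLp ξ 2 P) :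
    MemLp (stepProcess u v ξ) 2 (volume.prod P) := by
  have h1 : MemLp ((Ioc (u : ℝ) v).indicator (1 : ℝ → ℝ)) 2 volume :=
    memLp_indicator_const 2 measurableSet_Ioc 1 (Or.inr (by simp))
  have e : stepProcess u v ξ = fun p => (Ioc (u : ℝ) v).indicator 1 p.1 * ξ p.2 :=
    funext (stepProcess_eq_mul u v ξ)
  rw [e]
  refine (memLp_two_iff_integrable_sq (h1.1.comp_fst.mul hξ2.1.comp_snd)).2 ?_
  refine (h1.integrable_sq.mul_prod hξ2.integrable_sq).congr (ae_of_all _ fun p => ?_)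
  simp [mul_pow]

/-- Fubini gives the same closed form as `integral_elementary_mul`; this coincidence is the isometry
for single steps. -/
lemma integral_stepProcess_mul [SFinite P] {u v u' v' : ℝ≥0} {ξ η : Ω → ℝ} :
    ∫ p, stepProcess u v ξ p * stepProcess u' v' η p ∂(volume.prod P)
      = (∫ ω, ξ ω * η ω ∂P) * volume.real (Ioc (u : ℝ) v ∩ Ioc (u' : ℝ) v') := by
  have e : ∀ p : ℝ × Ω, stepProcess u v ξ p * stepProcess u' v' η p
      = (Ioc (u : ℝ) v ∩ Ioc (u' : ℝ) v').indicator 1 p.1 * (ξ p.2 * η p.2) := fun p => by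
    rw [stepProcess_eq_mul, stepProcess_eq_mul, inter_indicator_one, Pi.mul_apply]
    ring
  simp_rw [e]
  rw [integral_prod_mul (fun s : ℝ => (Ioc (u : ℝ) v ∩ Ioc (u' : ℝ) v').indicator 1 s)
    (fun ω => ξ ω * η ω), mul_comm, integral_indicator_one (measurableSet_Ioc.inter measurableSet_Ioc)]

namespace IsElementary

variable {φ ψ : ℝ × Ω → ℝ} {I J : Ω → ℝ}

lemma step {u v : ℝ≥0} {ξ : Ω → ℝ} (huv : u ≤ v)
    (hξ : StronglyMeasurable[augFiltration P W hW u] ξ) (hξ2 : MemLp ξ 2 P) :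
    IsElementary P W hW (stepProcess u v ξ) (fun ω => ξ ω * (W v ω - W u ω)) := by
  simpa using IsElementary.zero.add_step huv hξ hξ2

lemma add (h : IsElementary P W hW φ I) (h' : IsElementary P W hW ψ J) :
    IsElementary P W hW (φ + ψ) (I + J) := by
  induction h' with
  | zero => simpa using h
  | add_step _ huv hξ hξ2 ih =>
    rw [← add_assoc, ← add_assoc]
    exact ih.add_step huv hξ hξ2

lemma neg (h : IsElementary P W hW φ I) : IsElementary P W hW (-φ) (-I) := by
  induction h with
  | zero => simpa using IsElementary.zero
  | @add_step φ I u v ξ _ huv hξ hξ2 ih =>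
    convert! ih.add_step huv hξ.neg hξ2.neg using 1
    · rw [neg_add]
      congr 1
      ext p
      simp [stepProcess_eq_mul]
    · rw [neg_add]
      congr 1
      ext ω
      simp

lemma sub (h : IsElementary P W hW φ I) (h' : IsElementary P W hW ψ J) :
    IsElementary P W hW (φ - ψ) (I - J) := by
  rw [sub_eq_add_neg, sub_eq_add_neg]
  exact h.add h'.neg

lemma memLp_process [SFinite P] (h : IsElementary P W hW φ I) : MemLp φ 2 (volume.prod P) := by
  induction h with
  | zero => exact MemLp.zero
  | add_step _ _ _ hξ2 ih => exact ih.add (memLp_stepProcess hξ2)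

lemma memLp_integral (hB : IsPreBrownianReal W P) (h : IsElementary P W hW φ I) : MemLp I 2 P := by
  induction h with
  | zero => exact MemLp.zero
  | add_step _ huv hξ hξ2 ih => exact ih.add (memLp_mul_increment hB huv hξ hξ2)

lemma integral_step_mul [SFinite P] (hB : IsPreBrownianReal W P) {u v : ℝ≥0} {ξ : Ω → ℝ} (huv : u ≤ v)
    (hξ : StronglyMeasurable[augFiltration P W hW u] ξ) (hξ2 : MemLp ξ 2 P)
    (h : IsElementary P W hW φ I) :
    ∫ ω, (ξ ω * (W v ω - W u ω)) * I ω ∂P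
      = ∫ p, stepProcess u v ξ p * φ p ∂(volume.prod P) := by
  induction h with
  | zero => simp
  | add_step h' huv' hη hη2 ih =>
    have i1 := memLp_mul_increment hB huv hξ hξ2
    simp only [Pi.add_apply, mul_add]
    rw [integral_add (integrable_fun_mul i1 (h'.memLp_integral hB))
        (integrable_fun_mul i1 (memLp_mul_increment hB huv' hη hη2)),
      integral_add (integrable_fun_mul (memLp_stepProcess hξ2) h'.memLp_process)
        (integrable_fun_mul (memLp_stepProcess hξ2) (memLp_stepProcess hη2)),
      ih, integral_stepProcess_mul, integral_elementary_mul hB huv huv' hξ hξ2 hη hη2]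

/-- The Itô isometry for elementary processes, in polarised form. -/
lemma integral_mul [SFinite P] (hB : IsPreBrownianReal W P) (h : IsElementary P W hW φ I)
    (h' : IsElementary P W hW ψ J) :
    ∫ ω, I ω * J ω ∂P = ∫ p, φ p * ψ p ∂(volume.prod P) := by
  induction h with
  | zero => simp
  | add_step h1 huv hξ hξ2 ih =>
    simp only [Pi.add_apply, add_mul]
    rw [integral_add (integrable_fun_mul (h1.memLp_integral hB) (h'.memLp_integral hB))
        (integrable_fun_mul (memLp_mul_increment hB huv hξ hξ2) (h'.memLp_integral hB)),
      integral_add (integrable_fun_mul h1.memLp_process h'.memLp_process)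
        (integrable_fun_mul (memLp_stepProcess hξ2) h'.memLp_process),
      ih, h'.integral_step_mul hB huv hξ hξ2]

lemma eLpNorm_eq [SFinite P] (hB : IsPreBrownianReal W P) (h : IsElementary P W hW φ I) :
    eLpNorm I 2 P = eLpNorm φ 2 (volume.prod P) := by
  refine eLpNorm_eq_of_integral_sq_eq (h.memLp_integral hB) h.memLp_process ?_
  simp_rw [pow_two]
  exact h.integral_mul hB h

/-- Cutting an elementary process at time `s` changes its integral by a martingale increment. -/
lemma exists_restrict (hB : IsPreBrownianReal W P) (h : IsElementary P W hW φ I) (s : ℝ≥0) :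
    ∃ I', IsElementary P W hW (fun p => (Iic (s : ℝ)).indicator (fun r => φ (r, p.2)) p.1) I' ∧
      ∀ Y, StronglyMeasurable[augFiltration P W hW s] Y → MemLp Y 2 P →
        ∫ ω, Y ω * I ω ∂P = ∫ ω, Y ω * I' ω ∂P := by
  induction h with
  | zero =>
    refine ⟨0, ?_, by simp⟩
    convert! (IsElementary.zero : IsElementary P W hW 0 0) using 1
    ext p
    simp
  | @add_step φ I u v ξ h huv hξ hξ2 ih =>
    obtain ⟨I', hI', hY⟩ := ih
    have hmono {a b : ℝ≥0} (hab : a ≤ b) := (augFiltration P W hW).mono hab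
    -- A step after `s` is dropped, a step straddling `s` is cut to `(u, s]`, and a step before `s`
    -- is kept. Whatever is removed is an increment times a factor known at its start, so it has
    -- mean zero against `Y`.
    rcases le_total s u with hs | hs
    · refine ⟨I', ?_, fun Y hYm hY2 => ?_⟩
      · convert! hI' using 1
        ext p
        by_cases hp : p.1 ≤ s
        · have : ¬ (u : ℝ) < p.1 := not_lt.2 (hp.trans (NNReal.coe_le_coe.2 hs))
          simp [hp, stepProcess, this]
        · simp [hp]
      · simp only [Pi.add_apply, mul_add]
        rw [integral_add (integrable_fun_mul hY2 (h.memLp_integral hB))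
          (integrable_fun_mul hY2 (memLp_mul_increment hB huv hξ hξ2)), hY Y hYm hY2]
        have := integral_mul_increment hB huv ((hYm.mono (hmono hs)).mul hξ)
        simp only [Pi.mul_apply, mul_assoc] at this
        rw [this, add_zero]
    · rcases le_total s v with hv | hv
      · refine ⟨I' + fun ω => ξ ω * (W s ω - W u ω), ?_, fun Y hYm hY2 => ?_⟩
        · convert! hI'.add_step hs hξ hξ2 using 1
          ext p
          by_cases hp : p.1 ≤ s
          · have : p.1 ≤ v := hp.trans (NNReal.coe_le_coe.2 hv)
            simp [hp, stepProcess, this, indicator_apply]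
          · simp [hp, stepProcess, indicator_apply]
        · simp only [Pi.add_apply, mul_add]
          rw [integral_add (integrable_fun_mul hY2 (h.memLp_integral hB))
            (integrable_fun_mul hY2 (memLp_mul_increment hB huv hξ hξ2)), hY Y hYm hY2,
            integral_add (integrable_fun_mul hY2 (hI'.memLp_integral hB))
            (integrable_fun_mul hY2 (memLp_mul_increment hB hs hξ hξ2))]
          congr 1
          have h3 := integral_mul_increment hB hv (hYm.mul (hξ.mono (hmono hs)))
          simp only [Pi.mul_apply, mul_assoc] at h3
          have e : ∀ ω, Y ω * (ξ ω * (W v ω - W u ω)) = Y ω * (ξ ω * (W s ω - W u ω))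
            + Y ω * (ξ ω * (W v ω - W s ω)) := fun ω => by ring
          simp_rw [e]
          rw [integral_add (integrable_fun_mul hY2 (memLp_mul_increment hB hs hξ hξ2))
            (integrable_fun_mul hY2 (memLp_mul_increment hB hv (hξ.mono (hmono hs)) hξ2)),
            h3, add_zero]
      · refine ⟨I' + fun ω => ξ ω * (W v ω - W u ω), ?_, fun Y hYm hY2 => ?_⟩
        · convert! hI'.add_step huv hξ hξ2 using 1
          ext p
          by_cases hp : p.1 ≤ s
          · simp [hp]
          · have : ¬ p.1 ≤ v := fun hpv => hp (hpv.trans (NNReal.coe_le_coe.2 hv))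
            simp [hp, stepProcess, this]
        · simp only [Pi.add_apply, mul_add]
          rw [integral_add (integrable_fun_mul hY2 (h.memLp_integral hB))
            (integrable_fun_mul hY2 (memLp_mul_increment hB huv hξ hξ2)), hY Y hYm hY2,
            integral_add (integrable_fun_mul hY2 (hI'.memLp_integral hB))
            (integrable_fun_mul hY2 (memLp_mul_increment hB huv hξ hξ2))]

end IsElementary

/-- `I` is the `L²`-Itô integral of `φ` over the whole time axis. -/
structure IsItoLimit (P : Measure Ω) (W : ℝ≥0 → Ω → ℝ) (hW : ∀ s, Measurable (W s))
    (φ : ℝ × Ω → ℝ) (I : Ω → ℝ) : Prop where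
  memLp_process : MemLp φ 2 (volume.prod P)
  memLp_integral : MemLp I 2 P
  exists_seq : ∃ (Φ : ℕ → ℝ × Ω → ℝ) (J : ℕ → Ω → ℝ), (∀ n, IsElementary P W hW (Φ n) (J n)) ∧
    Tendsto (fun n => eLpNorm (Φ n - φ) 2 (volume.prod P)) atTop (𝓝 0) ∧
    Tendsto (fun n => eLpNorm (J n - I) 2 P) atTop (𝓝 0)

lemma IsElementary.isItoLimit [SFinite P] (hB : IsPreBrownianReal W P) {φ : ℝ × Ω → ℝ} {I : Ω → ℝ}
    (h : IsElementary P W hW φ I) : IsItoLimit P W hW φ I :=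
  ⟨h.memLp_process, h.memLp_integral hB, fun _ => φ, fun _ => I, fun _ => h, by simp, by simp⟩

namespace IsItoLimit

variable {φ ψ : ℝ × Ω → ℝ} {I J : Ω → ℝ}

lemma congr (h : IsItoLimit P W hW φ I) (e : φ =ᵐ[volume.prod P] ψ) (e' : I =ᵐ[P] J) :
    IsItoLimit P W hW ψ J := by
  obtain ⟨Φ, K, hΦ, h1, h2⟩ := h.exists_seq
  refine ⟨h.memLp_process.ae_eq e, h.memLp_integral.ae_eq e', Φ, K, hΦ, ?_, ?_⟩
  · convert! h1 using 2 with n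
    exact eLpNorm_congr_ae ((ae_eq_refl _).sub e.symm)
  · convert! h2 using 2 with n
    exact eLpNorm_congr_ae ((ae_eq_refl _).sub e'.symm)

lemma sub [SFinite P] (hB : IsPreBrownianReal W P) (h : IsItoLimit P W hW φ I)
    (h' : IsItoLimit P W hW ψ J) : IsItoLimit P W hW (φ - ψ) (I - J) := by
  obtain ⟨Φ, K, hΦ, h1, h2⟩ := h.exists_seq
  obtain ⟨Φ', K', hΦ', h1', h2'⟩ := h'.exists_seq
  refine ⟨h.memLp_process.sub h'.memLp_process, h.memLp_integral.sub h'.memLp_integral,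
    fun n => Φ n - Φ' n, fun n => K n - K' n, fun n => (hΦ n).sub (hΦ' n), ?_, ?_⟩
  · have hz := h1.add h1'
    rw [add_zero] at hz
    refine tendsto_of_tendsto_of_tendsto_of_le_of_le tendsto_const_nhds hz (fun _ => zero_le)
      fun n => ?_
    have := eLpNorm_sub_le (((hΦ n).memLp_process.sub h.memLp_process).1)
      (((hΦ' n).memLp_process.sub h'.memLp_process).1) (p := 2) (by norm_num)
    rwa [sub_sub_sub_comm] at this
  · have hz := h2.add h2'
    rw [add_zero] at hz
    refine tendsto_of_tendsto_of_tendsto_of_le_of_le tendsto_const_nhds hz (fun _ => zero_le)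
      fun n => ?_
    have := eLpNorm_sub_le ((((hΦ n).memLp_integral hB).sub h.memLp_integral).1)
      ((((hΦ' n).memLp_integral hB).sub h'.memLp_integral).1) (p := 2) (by norm_num)
    rwa [sub_sub_sub_comm] at this

/-- The Itô isometry. -/
lemma eLpNorm_eq [SFinite P] (hB : IsPreBrownianReal W P) (h : IsItoLimit P W hW φ I) :
    eLpNorm I 2 P = eLpNorm φ 2 (volume.prod P) := by
  obtain ⟨Φ, K, hΦ, h1, h2⟩ := h.exists_seq
  -- The approximants have equal norms, so by the triangle inequality the norms of `I` and `φ`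
  -- differ by at most this sum of errors.
  have key : Tendsto (fun n => eLpNorm (K n - I) 2 P + eLpNorm (Φ n - φ) 2 (volume.prod P))
      atTop (𝓝 0) := by simpa using h2.add h1
  have a1 : ∀ n, eLpNorm I 2 P ≤ eLpNorm (K n - I) 2 P + eLpNorm (K n) 2 P := fun n => by
    have := eLpNorm_sub_le ((hΦ n).memLp_integral hB).1
      (((hΦ n).memLp_integral hB).sub h.memLp_integral).1 (p := 2) (by norm_num)
    rw [sub_sub_cancel] at this
    rwa [add_comm]
  have a2 : ∀ n, eLpNorm (K n) 2 P ≤ eLpNorm (K n - I) 2 P + eLpNorm I 2 P := fun n => by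
    have := eLpNorm_add_le (((hΦ n).memLp_integral hB).sub h.memLp_integral).1
      h.memLp_integral.1 (p := 2) (by norm_num)
    rwa [sub_add_cancel] at this
  have a3 : ∀ n, eLpNorm φ 2 (volume.prod P)
      ≤ eLpNorm (Φ n - φ) 2 (volume.prod P) + eLpNorm (Φ n) 2 (volume.prod P) := fun n => by
    have := eLpNorm_sub_le (hΦ n).memLp_process.1
      ((hΦ n).memLp_process.sub h.memLp_process).1 (p := 2) (by norm_num)
    rw [sub_sub_cancel] at this
    rwa [add_comm]
  have a4 : ∀ n, eLpNorm (Φ n) 2 (volume.prod P)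
      ≤ eLpNorm (Φ n - φ) 2 (volume.prod P) + eLpNorm φ 2 (volume.prod P) := fun n => by
    have := eLpNorm_add_le ((hΦ n).memLp_process.sub h.memLp_process).1
      h.memLp_process.1 (p := 2) (by norm_num)
    rwa [sub_add_cancel] at this
  apply le_antisymm
  · have t := key.add_const (eLpNorm φ 2 (volume.prod P))
    rw [zero_add] at t
    refine ge_of_tendsto' t fun n => ?_
    calc eLpNorm I 2 P ≤ eLpNorm (K n - I) 2 P + eLpNorm (K n) 2 P := a1 n
      _ ≤ _ := by
        rw [(hΦ n).eLpNorm_eq hB, add_assoc]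
        gcongr
        exact a4 n
  · have t := key.add_const (eLpNorm I 2 P)
    rw [zero_add] at t
    refine ge_of_tendsto' t fun n => ?_
    calc _ ≤ _ := a3 n
      _ ≤ _ := by
        rw [← (hΦ n).eLpNorm_eq hB, add_comm (eLpNorm (K n - I) 2 P), add_assoc]
        gcongr
        exact a2 n

lemma integral_sq_eq [SFinite P] (hB : IsPreBrownianReal W P) (h : IsItoLimit P W hW φ I) :
    ∫ ω, I ω ^ 2 ∂P = ∫ p, φ p ^ 2 ∂(volume.prod P) := by
  rw [integral_sq_eq_toReal h.memLp_integral.1, integral_sq_eq_toReal h.memLp_process.1,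
    h.eLpNorm_eq hB]

/-- The Itô integral of a process that vanishes up to time `s` is orthogonal to `F_s`. -/
lemma integral_mul_eq_zero [SFinite P] (hB : IsPreBrownianReal W P) (h : IsItoLimit P W hW φ I)
    {s : ℝ≥0} (hs : ∀ p : ℝ × Ω, p.1 ≤ s → φ p = 0) {Y : Ω → ℝ}
    (hY : StronglyMeasurable[augFiltration P W hW s] Y) (hY2 : MemLp Y 2 P) :
    ∫ ω, Y ω * I ω ∂P = 0 := by
  obtain ⟨Φ, K, hΦ, h1, h2⟩ := h.exists_seq
  choose K' hK' hK using fun n => (hΦ n).exists_restrict hB s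
  have l1 := tendsto_integral_mul hY2 (fun n => (hΦ n).memLp_integral hB) h.memLp_integral h2
  -- Since `φ` vanishes up to `s`, the part of `Φ n` before `s` is dominated by `Φ n - φ`. The
  -- integrals of the cut approximants thus tend to zero, while their pairings with `Y` agree with
  -- those of the uncut ones.
  have l2 : Tendsto (fun n => eLpNorm (K' n - 0) 2 P) atTop (𝓝 0) := by
    refine tendsto_of_tendsto_of_tendsto_of_le_of_le tendsto_const_nhds h1 (fun _ => zero_le)
      fun n => ?_
    simp only [sub_zero]
    rw [(hK' n).eLpNorm_eq hB]
    refine eLpNorm_mono fun p => ?_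
    by_cases hp : p.1 ≤ s
    · simp [hp, hs p hp]
    · simp [hp]
  have l3 := tendsto_integral_mul hY2 (fun n => (hK' n).memLp_integral hB) MemLp.zero l2
  simp only [Pi.zero_apply, mul_zero, integral_zero] at l3
  refine tendsto_nhds_unique l1 (l3.congr fun n => ?_)
  exact (hK n Y hY hY2).symm

end IsItoLimit

end Elementary

/-! ### Processes restricted to a time interval -/

section TimeRestrict

variable {Ω : Type*}

/-- The process `g 1_{(a, b]}`, as a function of real time and scenario. -/
noncomputable def timeRestrict (a b : ℝ≥0) (g : ℝ≥0 → Ω → ℝ) (p : ℝ × Ω) : ℝ :=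
  (Ioc (a : ℝ) b).indicator (fun s => g s.toNNReal p.2) p.1

lemma mem_Ioc_toNNReal {a b : ℝ≥0} {s : ℝ} (h : s ∈ Ioc (a : ℝ) b) : s.toNNReal ∈ Ioc a b := by
  refine ⟨?_, Real.toNNReal_le_iff_le_coe.2 h.2⟩
  rw [Real.lt_toNNReal_iff_coe_lt]
  exact h.1

lemma timeRestrict_congr {a b : ℝ≥0} {g h : ℝ≥0 → Ω → ℝ} {p : ℝ × Ω}
    (e : ∀ s ∈ Ioc a b, g s p.2 = h s p.2) : timeRestrict a b g p = timeRestrict a b h p := by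
  unfold timeRestrict
  by_cases hp : p.1 ∈ Ioc (a : ℝ) b
  · rw [indicator_of_mem hp, indicator_of_mem hp, e _ (mem_Ioc_toNNReal hp)]
  · rw [indicator_of_notMem hp, indicator_of_notMem hp]

lemma timeRestrict_sub (a b : ℝ≥0) (g h : ℝ≥0 → Ω → ℝ) :
    timeRestrict a b (fun s ω => g s ω - h s ω) = timeRestrict a b g - timeRestrict a b h := by
  ext p
  simp only [timeRestrict, Pi.sub_apply]
  by_cases hp : p.1 ∈ Ioc (a : ℝ) b
  · simp only [indicator_of_mem hp]
  · simp only [indicator_of_notMem hp, sub_zero]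

/-- Subtracting the parts of a process before two times leaves the part in between. -/
lemma timeRestrict_sub_timeRestrict {a s b : ℝ≥0} (has : a ≤ s) (hsb : s ≤ b) (g : ℝ≥0 → Ω → ℝ) :
    timeRestrict a b g - timeRestrict a s g = timeRestrict s b g := by
  have h1 : (a : ℝ) ≤ s := has
  have h2 : (s : ℝ) ≤ b := hsb
  ext p
  simp only [timeRestrict, Pi.sub_apply, indicator_apply, mem_Ioc]
  by_cases hp : (s : ℝ) < p.1
  · simp [hp, h1.trans_lt hp, not_le.2 hp]
  · have hp' := not_lt.1 hp
    simp [hp, hp', hp'.trans h2]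

variable [mΩ : MeasurableSpace Ω] {P : Measure Ω}

lemma stronglyMeasurable_timeRestrict {g : ℝ≥0 → Ω → ℝ} (a b : ℝ≥0)
    (hg : StronglyMeasurable (Function.uncurry g)) : StronglyMeasurable (timeRestrict a b g) := by
  have h1 : StronglyMeasurable fun p : ℝ × Ω => g p.1.toNNReal p.2 :=
    hg.comp_measurable (g := fun p : ℝ × Ω => (p.1.toNNReal, p.2)) (by fun_prop)
  exact h1.indicator (s := {p : ℝ × Ω | p.1 ∈ Ioc (a : ℝ) b})
    (measurableSet_Ioc.preimage measurable_fst)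

lemma energy_eq [SFinite P] {a b : ℝ≥0} {g : ℝ≥0 → Ω → ℝ}
    (hg : AEStronglyMeasurable (timeRestrict a b g) (volume.prod P)) :
    energy P a b g = eLpNorm (timeRestrict a b g) 2 (volume.prod P) ^ 2 := by
  rw [eLpNorm_two_sq, lintegral_prod_symm _ (by fun_prop), energy]
  refine lintegral_congr fun ω => ?_
  rw [setLIntegral_congr Ioc_ae_eq_Icc.symm, ← lintegral_indicator measurableSet_Ioc]
  refine lintegral_congr fun s => ?_
  by_cases hp : s ∈ Ioc (a : ℝ) b <;> simp [timeRestrict, hp]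

/-- Second moments of a time-restricted process. -/
lemma integral_timeRestrict_sq_le [SFinite P] {a b : ℝ≥0} (hab : a ≤ b) {g : ℝ≥0 → Ω → ℝ} {C : ℝ}
    (hg : MemLp (timeRestrict a b g) 2 (volume.prod P))
    (hC : ∀ s ∈ Ioc a b, ∫ ω, g s ω ^ 2 ∂P ≤ C) :
    ∫ p, timeRestrict a b g p ^ 2 ∂(volume.prod P) ≤ C * ((b : ℝ) - a) := by
  rw [integral_prod _ hg.integrable_sq]
  have e : ∀ s : ℝ, ∫ ω, timeRestrict a b g (s, ω) ^ 2 ∂P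
      = (Ioc (a : ℝ) b).indicator (fun s => ∫ ω, g s.toNNReal ω ^ 2 ∂P) s := fun s => by
    by_cases hp : s ∈ Ioc (a : ℝ) b <;> simp [timeRestrict, hp]
  simp_rw [e]
  have hi := hg.integrable_sq.integral_prod_left
  simp_rw [e] at hi
  have hc : Integrable ((Ioc (a : ℝ) b).indicator fun _ => C) :=
    (integrable_indicator_iff measurableSet_Ioc).2 (by simp)
  calc _ ≤ ∫ s, (Ioc (a : ℝ) b).indicator (fun _ => C) s := by
        refine integral_mono hi hc fun s => ?_
        by_cases hp : s ∈ Ioc (a : ℝ) b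
        · simpa [hp] using hC _ (mem_Ioc_toNNReal hp)
        · simp [hp]
    _ = C * ((b : ℝ) - a) := by
        rw [integral_indicator measurableSet_Ioc, setIntegral_const, Real.volume_real_Ioc_of_le (NNReal.coe_le_coe.2 hab),
          smul_eq_mul, mul_comm]

end TimeRestrict

/-! ### From simple processes to `L²` Itô integrals -/

section Bridge

variable {Ω : Type*} [mΩ : MeasurableSpace Ω] {P : Measure Ω} [IsFiniteMeasure P]
  {W : ℝ≥0 → Ω → ℝ} {hW : ∀ s, Measurable (W s)}

lemma SimpleProcess.isElementary (Φ : SimpleProcess (augFiltration P W hW)) {a b : ℝ≥0}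
    (hab : a ≤ b) :
    IsElementary P W hW (timeRestrict a b Φ.value) (Φ.integral W a b) := by
  have key : ∀ n, IsElementary P W hW
      (timeRestrict a b fun s ω => ∑ i ∈ Finset.range n,
        (Ioc (Φ.time i) (Φ.time (i + 1))).indicator (fun _ => Φ.coeff i ω) s)
      (fun ω => ∑ i ∈ Finset.range n, Φ.coeff i ω *
        (W (max a (min (Φ.time (i + 1)) b)) ω - W (max a (min (Φ.time i) b)) ω)) := by
    intro n
    induction n with
    | zero =>
      convert! (IsElementary.zero : IsElementary P W hW 0 0) using 1
      · ext p
        simp [timeRestrict]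
    | succ n ih =>
      simp only [Finset.sum_range_succ]
      have hn := Φ.time_mono (Nat.le_succ n)
      -- Clamping the partition times to `[a, b]` could move the left end before `time n`, where the
      -- coefficient need not be measurable. This happens only for steps starting after `b`, which
      -- contribute nothing; otherwise clamping can only move the left end to the right.
      rcases le_total b (Φ.time n) with hb | hb
      · convert! ih using 1
        · ext p
          refine timeRestrict_congr fun s hs => ?_
          rw [indicator_of_notMem, add_zero]
          exact fun h => (h.1.trans_le (hs.2.trans hb)).false
        · ext ω
          rw [min_eq_right hb, min_eq_right (hb.trans hn)]
          simp
      · have hu : Φ.time n ≤ max a (min (Φ.time n) b) := by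
          rw [min_eq_left hb]
          exact le_max_right _ _
        obtain ⟨C, hC⟩ := Φ.coeff_bdd
        have hm := (Φ.coeff_meas n).mono ((augFiltration P W hW).mono hu)
        have := ih.add_step (max_le_max le_rfl (min_le_min hn le_rfl)) hm
          (MemLp.of_bound (stronglyMeasurable_of_augFiltration hm).aestronglyMeasurable C
            (ae_of_all _ fun ω => hC n ω))
        convert! this using 1
        ext p
        simp only [timeRestrict, Pi.add_apply, stepProcess, indicator_apply, mem_Ioc]
        have e : ((max a (min (Φ.time n) b) : ℝ≥0) : ℝ) < p.1
              ∧ p.1 ≤ ((max a (min (Φ.time (n + 1)) b) : ℝ≥0) : ℝ) ↔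
            ((a : ℝ) < p.1 ∧ p.1 ≤ b) ∧
              (Φ.time n < p.1.toNNReal ∧ p.1.toNNReal ≤ Φ.time (n + 1)) := by
          have := NNReal.coe_le_coe.2 hab
          have := NNReal.coe_le_coe.2 hb
          rw [Real.lt_toNNReal_iff_coe_lt, Real.toNNReal_le_iff_le_coe]
          push_cast
          rw [max_lt_iff, le_max_iff, min_eq_left this, le_min_iff]
          constructor
          · rintro ⟨⟨h1, h2⟩, h3 | h3⟩
            · exact absurd h1 (not_lt.2 h3)
            · exact ⟨⟨h1, h3.2⟩, h2, h3.1⟩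
          · rintro ⟨⟨h1, h2⟩, h3, h4⟩
            exact ⟨⟨h1, h3⟩, Or.inr ⟨h4, h2⟩⟩
        simp only [e]
        by_cases h1 : (a : ℝ) < p.1 ∧ p.1 ≤ b
        · simp [h1]
        · simp [h1]
  exact key Φ.n

/-- The measurability hypotheses allow the energy to be read as a squared norm on the product space.
Square-integrability of `φ` and `I` is inherited from an approximant at finite distance. -/
lemma IsItoIntegral.isItoLimit (hB : IsPreBrownianReal W P) {φ : ℝ≥0 → Ω → ℝ} {a b : ℝ≥0}
    {I : Ω → ℝ} (hab : a ≤ b) (h : IsItoIntegral P (augFiltration P W hW) W φ a b I)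
    (hφ : AEStronglyMeasurable (timeRestrict a b φ) (volume.prod P))
    (hI : AEStronglyMeasurable I P) :
    IsItoLimit P W hW (timeRestrict a b φ) I := by
  obtain ⟨Φ, h1, h2⟩ := h
  have hE := fun n => (Φ n).isElementary hab
  have e1 : ∀ n, energy P a b (fun s ω => (Φ n).value s ω - φ s ω)
      = eLpNorm (timeRestrict a b (Φ n).value - timeRestrict a b φ) 2 (volume.prod P) ^ 2 :=
    fun n => by
      rw [energy_eq, timeRestrict_sub]
      rw [timeRestrict_sub]
      exact (hE n).memLp_process.1.sub hφ
  have sq : ∀ u : ℕ → ℝ≥0∞, Tendsto (fun n => u n ^ 2) atTop (𝓝 0) → Tendsto u atTop (𝓝 0) := by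
    intro u hu
    have := hu.ennrpow_const (1 / 2)
    rw [ENNReal.zero_rpow_of_pos (by norm_num)] at this
    refine this.congr fun n => ?_
    rw [← ENNReal.rpow_natCast, ← ENNReal.rpow_mul]
    norm_num
  have t1 : Tendsto (fun n => eLpNorm (timeRestrict a b (Φ n).value - timeRestrict a b φ) 2
      (volume.prod P)) atTop (𝓝 0) := sq _ (by simpa only [e1] using h1)
  have t2 : Tendsto (fun n => eLpNorm ((Φ n).integral W a b - I) 2 P) atTop (𝓝 0) :=
    sq _ (by
      simp only [eLpNorm_two_sq]
      exact h2)
  have fin : ∀ {α : Type _} {m : MeasurableSpace α} {μ : Measure α} {F : ℕ → α → ℝ} {f : α → ℝ},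
      (∀ n, MemLp (F n) 2 μ) → AEStronglyMeasurable f μ →
      Tendsto (fun n => eLpNorm (F n - f) 2 μ) atTop (𝓝 0) → MemLp f 2 μ := by
    intro α m μ F f hF hf ht
    obtain ⟨n, hn⟩ := (ht.eventually_lt_const ENNReal.zero_lt_top).exists
    have := (hF n).sub (⟨(hF n).1.sub hf, hn⟩ : MemLp (F n - f) 2 μ)
    rwa [sub_sub_cancel] at this
  exact ⟨fin (fun n => (hE n).memLp_process) hφ t1,
    fin (fun n => (hE n).memLp_integral hB) hI t2, _, _, hE, t1, t2⟩

end Bridge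

/-! ### The price process -/

section Price

variable {Ω : Type*} [mΩ : MeasurableSpace Ω]

/-- An adapted process that solves the price equation with jointly measurable `L²`-integrals. -/
structure IsRegularPrice (P : Measure Ω) (W : ℝ≥0 → Ω → ℝ) (hW : ∀ s, Measurable (W s))
    (t T : ℝ≥0) (x : ℝ) (X : ℝ≥0 → Ω → ℝ) : Prop where
  adapted : ∀ r ∈ Icc t T, StronglyMeasurable[augFiltration P W hW r] (X r)
  ito : ∀ r ∈ Icc t T, IsItoLimit P W hW (timeRestrict t r X) fun ω => X r ω - x

variable {P : Measure Ω} {W : ℝ≥0 → Ω → ℝ} {hW : ∀ s, Measurable (W s)} {t T : ℝ≥0} {x : ℝ}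
  {X : ℝ≥0 → Ω → ℝ}

/-- A continuous adapted process is indistinguishable on `[t, T]` from one with continuous paths. -/
lemma IsContAdapted.exists_continuous (htT : t ≤ T)
    (hX : IsContAdapted P (augFiltration P W hW) t T X) :
    ∃ X' : ℝ≥0 → Ω → ℝ,
      (∀ r ∈ Icc t T, StronglyMeasurable[augFiltration P W hW r] (X' r)) ∧
      StronglyMeasurable (Function.uncurry X') ∧ (∀ ω, Continuous fun r => X' r ω) ∧
      ∀ᵐ ω ∂P, ∀ r ∈ Icc t T, X' r ω = X r ω := by
  -- The set of discontinuous paths need not be measurable; its measurable hull is still null, hence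
  -- belongs to every augmented σ-algebra. Setting the paths to zero there preserves adaptedness.
  set N := toMeasurable P {ω | ¬ ContinuousOn (fun r => X r ω) (Icc t T)} with hN
  have hNm : MeasurableSet N := measurableSet_toMeasurable _ _
  have hN0 : P N = 0 := by
    rw [hN, measure_toMeasurable]
    exact ae_iff.1 hX.cont
  have hNc : ∀ ω ∉ N, ContinuousOn (fun r => X r ω) (Icc t T) := fun ω hω => by
    by_contra h
    exact hω (subset_toMeasurable _ _ h)
  have hmem : ∀ r : ℝ≥0, max t (min r T) ∈ Icc t T := fun r =>
    ⟨le_max_left _ _, max_le htT (min_le_right _ _)⟩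
  have had : ∀ r ∈ Icc t T,
      StronglyMeasurable[augFiltration P W hW r] (Nᶜ.indicator (X r)) := fun r hr =>
    (hX.adapted r hr).indicator (measurableSet_augFiltration_of_null hNm hN0 r).compl
  have hc : ∀ ω, Continuous fun r => Nᶜ.indicator (X (max t (min r T))) ω := fun ω => by
    by_cases hω : ω ∈ N
    · simp [hω, continuous_const]
    · simp only [indicator_of_mem (mem_compl hω)]
      exact (hNc ω hω).comp_continuous (by fun_prop) hmem
  refine ⟨fun r => Nᶜ.indicator (X (max t (min r T))), fun r hr => ?_, ?_, hc, ?_⟩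
  · beta_reduce
    rw [min_eq_left hr.2, max_eq_right hr.1]
    exact had r hr
  · have h := stronglyMeasurable_uncurry_of_continuous_of_stronglyMeasurable
      (u := fun r => Nᶜ.indicator (X (max t (min r T)))) hc
      fun r => stronglyMeasurable_of_augFiltration (had _ (hmem r))
    exact h
  · have : ∀ᵐ ω ∂P, ω ∉ N := measure_eq_zero_iff_ae_notMem.1 hN0
    filter_upwards [this] with ω hω r hr
    rw [min_eq_left hr.2, max_eq_right hr.1, indicator_of_mem (mem_compl hω)]

/-- Almost sure continuity does not make `X` jointly measurable, which the product-space norms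
require; an indistinguishable continuous version is, and it has the same Itô integrals. -/
lemma IsPriceProcess.exists_regular [IsFiniteMeasure P] (hB : IsPreBrownianReal W P) (htT : t ≤ T)
    (hX : IsPriceProcess P (augFiltration P W hW) W t T x X) :
    ∃ X', IsRegularPrice P W hW t T x X' ∧ ∀ᵐ ω ∂P, ∀ r ∈ Icc t T, X' r ω = X r ω := by
  obtain ⟨X', h1, h2, -, h4⟩ := hX.toIsContAdapted.exists_continuous htT
  refine ⟨X', ⟨h1, fun r hr => ?_⟩, h4⟩
  have e : timeRestrict t r X =ᵐ[volume.prod P] timeRestrict t r X' := by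
    filter_upwards [Measure.quasiMeasurePreserving_snd.ae h4] with p hp
    exact timeRestrict_congr fun s hs => (hp s ⟨hs.1.le, hs.2.trans hr.2⟩).symm
  have m := (hX.eqn r hr).isItoLimit hB hr.1
    ((stronglyMeasurable_timeRestrict t r h2).aestronglyMeasurable.congr e.symm)
    ((stronglyMeasurable_of_augFiltration (hX.adapted r hr)).aestronglyMeasurable.sub
      aestronglyMeasurable_const)
  refine m.congr e ?_
  filter_upwards [h4] with ω hω
  rw [hω r hr]

namespace IsRegularPrice

variable [IsProbabilityMeasure P]

lemma memLp (hX : IsRegularPrice P W hW t T x X) {r : ℝ≥0} (hr : r ∈ Icc t T) :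
    MemLp (X r) 2 P := by
  have := (hX.ito r hr).memLp_integral.add (memLp_const x)
  refine this.ae_eq (ae_of_all _ fun ω => ?_)
  simp

lemma ito_sub (hB : IsPreBrownianReal W P) (hX : IsRegularPrice P W hW t T x X) {s r : ℝ≥0}
    (hts : t ≤ s) (hsr : s ≤ r) (hrT : r ≤ T) :
    IsItoLimit P W hW (timeRestrict s r X) fun ω => X r ω - X s ω := by
  have := (hX.ito r ⟨hts.trans hsr, hrT⟩).sub hB (hX.ito s ⟨hts, hsr.trans hrT⟩)
  rw [timeRestrict_sub_timeRestrict hts hsr] at this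
  exact this.congr (ae_eq_refl _) (ae_of_all _ fun ω => by simp)

/-- The martingale property of the price. -/
lemma integral_mul_sub_eq_zero (hB : IsPreBrownianReal W P) (hX : IsRegularPrice P W hW t T x X)
    {s r : ℝ≥0} (hts : t ≤ s) (hsr : s ≤ r) (hrT : r ≤ T) {Y : Ω → ℝ}
    (hY : StronglyMeasurable[augFiltration P W hW s] Y) (hY2 : MemLp Y 2 P) :
    ∫ ω, Y ω * (X r ω - X s ω) ∂P = 0 := by
  refine (hX.ito_sub hB hts hsr hrT).integral_mul_eq_zero hB (fun p hp => ?_) hY hY2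
  simp [timeRestrict, not_lt.2 hp]

lemma integral_mul_eq (hB : IsPreBrownianReal W P) (hX : IsRegularPrice P W hW t T x X)
    {s r : ℝ≥0} (hts : t ≤ s) (hsr : s ≤ r) (hrT : r ≤ T) {Y : Ω → ℝ}
    (hY : StronglyMeasurable[augFiltration P W hW s] Y) (hY2 : MemLp Y 2 P) :
    ∫ ω, Y ω * X s ω ∂P = ∫ ω, Y ω * X r ω ∂P := by
  have := hX.integral_mul_sub_eq_zero hB hts hsr hrT hY hY2
  simp_rw [mul_sub] at this
  rw [integral_sub (integrable_fun_mul hY2 (hX.memLp ⟨hts.trans hsr, hrT⟩))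
    (integrable_fun_mul hY2 (hX.memLp ⟨hts, hsr.trans hrT⟩))] at this
  linarith

/-- The equation at `r = t` integrates over an empty interval, so the isometry gives `X_t - x` norm
zero. -/
lemma ae_eq_initial (hB : IsPreBrownianReal W P) (hX : IsRegularPrice P W hW t T x X)
    (htT : t ≤ T) : ∀ᵐ ω ∂P, X t ω = x := by
  have h := hX.ito t ⟨le_rfl, htT⟩
  have h0 := h.eLpNorm_eq hB
  have e : timeRestrict t t X = 0 := by
    ext p
    simp [timeRestrict]
  rw [e, eLpNorm_zero, eLpNorm_eq_zero_iff h.memLp_integral.1 (by norm_num)] at h0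
  filter_upwards [h0] with ω hω
  simpa [sub_eq_zero] using hω

lemma integral_eq (hB : IsPreBrownianReal W P) (hX : IsRegularPrice P W hW t T x X)
    {r : ℝ≥0} (hr : r ∈ Icc t T) : ∫ ω, X r ω ∂P = x := by
  have h := hX.integral_mul_eq hB le_rfl hr.1 hr.2 (Y := fun _ => 1)
    stronglyMeasurable_const (memLp_const 1)
  simp only [one_mul] at h
  rw [← h, integral_congr_ae (hX.ae_eq_initial hB (hr.1.trans hr.2))]
  simp

/-- By the isometry, `E (X_r - x)²` is at most the square integral of the price over `(t, T]`,
uniformly in `r`. -/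
lemma exists_integral_sq_le (hB : IsPreBrownianReal W P) (hX : IsRegularPrice P W hW t T x X)
    (htT : t ≤ T) : ∃ C, 0 ≤ C ∧ ∀ r ∈ Icc t T, ∫ ω, X r ω ^ 2 ∂P ≤ C := by
  refine ⟨2 * (∫ p, timeRestrict t T X p ^ 2 ∂(volume.prod P)) + 2 * x ^ 2, ?_, fun r hr => ?_⟩
  · have : 0 ≤ ∫ p, timeRestrict t T X p ^ 2 ∂(volume.prod P) :=
      integral_nonneg fun p => sq_nonneg _
    positivity
  have h := hX.ito r hr
  have h1 : ∫ ω, (X r ω - x) ^ 2 ∂P ≤ ∫ p, timeRestrict t T X p ^ 2 ∂(volume.prod P) := by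
    rw [h.integral_sq_eq hB]
    refine integral_mono h.memLp_process.integrable_sq
      (hX.ito T ⟨htT, le_rfl⟩).memLp_process.integrable_sq fun p => ?_
    by_cases hp : p.1 ∈ Ioc (t : ℝ) r
    · have : p.1 ∈ Ioc (t : ℝ) T := ⟨hp.1, hp.2.trans (NNReal.coe_le_coe.2 hr.2)⟩
      simp [timeRestrict, hp, this]
    · simp [timeRestrict, hp, sq_nonneg]
  calc ∫ ω, X r ω ^ 2 ∂P ≤ ∫ ω, (2 * (X r ω - x) ^ 2 + 2 * x ^ 2) ∂P := by
        refine integral_mono (hX.memLp hr).integrable_sq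
          ((h.memLp_integral.integrable_sq.const_mul 2).add (integrable_const _)) fun ω => ?_
        simp only
        nlinarith [sq_nonneg (X r ω - x - x)]
    _ = 2 * (∫ ω, (X r ω - x) ^ 2 ∂P) + 2 * x ^ 2 := by
        rw [integral_add (h.memLp_integral.integrable_sq.const_mul 2) (integrable_const _),
          integral_const_mul]
        simp
    _ ≤ _ := by gcongr

/-- The Euler step approximates the price with a second-order error. -/
lemma integral_euler_error_sq_le (hB : IsPreBrownianReal W P)
    (hX : IsRegularPrice P W hW t T x X) {C : ℝ} (hC : ∀ r ∈ Icc t T, ∫ ω, X r ω ^ 2 ∂P ≤ C)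
    {s r : ℝ≥0} (hts : t ≤ s) (hsr : s ≤ r) (hrT : r ≤ T) :
    MemLp (fun ω => X r ω - X s ω - X s ω * (W r ω - W s ω)) 2 P ∧
    ∫ ω, (X r ω - X s ω - X s ω * (W r ω - W s ω)) ^ 2 ∂P ≤ C * ((r : ℝ) - s) ^ 2 := by
  have hs : s ∈ Icc t T := ⟨hts, hsr.trans hrT⟩
  have hC0 : 0 ≤ C := (integral_nonneg fun ω => sq_nonneg _).trans (hC s hs)
  -- The error is the Itô integral of `X_u - X_s` over `(s, r]`. One isometry reduces it to `E (X_u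
  -- - X_s)²`, a second bounds that by `C (u - s)`; each contributes one factor `r - s`.
  have h1 := (hX.ito_sub hB hts hsr hrT).sub hB
    ((IsElementary.step hsr (hX.adapted s hs) (hX.memLp hs)).isItoLimit hB)
  have e : timeRestrict s r X - stepProcess s r (X s)
      = timeRestrict s r fun u ω => X u ω - X s ω :=
    (timeRestrict_sub s r X fun _ => X s).symm
  rw [e] at h1
  refine ⟨h1.memLp_integral, ?_⟩
  refine (h1.integral_sq_eq hB).trans_le ?_
  have hrs : (0 : ℝ) ≤ r - s := sub_nonneg.2 (NNReal.coe_le_coe.2 hsr)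
  refine (integral_timeRestrict_sq_le hsr h1.memLp_process (C := C * ((r : ℝ) - s))
    fun u hu => ?_).trans_eq (by ring)
  have h2 := hX.ito_sub hB hts hu.1.le (hu.2.trans hrT)
  rw [h2.integral_sq_eq hB]
  refine (integral_timeRestrict_sq_le hu.1.le h2.memLp_process (C := C)
    fun w hw => hC w ⟨hts.trans hw.1.le, hw.2.trans (hu.2.trans hrT)⟩).trans ?_
  have : (u : ℝ) ≤ r := hu.2
  gcongr

end IsRegularPrice

end Price

/-- A nonnegative function that grows at most linearly relative to itself, up to second-order
errors, and vanishes initially, is zero. -/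
lemma eq_zero_of_quadratic_growth {d : ℝ≥0 → ℝ} {t T : ℝ≥0} {C : ℝ} (hC : 0 ≤ C)
    (hd : ∀ r, 0 ≤ d r) (h0 : d t = 0)
    (hstep : ∀ s r : ℝ≥0, t ≤ s → s ≤ r → r ≤ T → (r : ℝ) - s ≤ 1 →
      d r ≤ (1 + 3 * ((r : ℝ) - s)) * d s + C * ((r : ℝ) - s) ^ 2)
    {r : ℝ≥0} (hr : r ∈ Icc t T) : d r = 0 := by
  set L : ℝ≥0 := r - t with hL
  have hLr : t + L = r := add_tsub_cancel_of_le hr.1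
  -- With `n` equal steps there are `n` errors of size `C (L / n)²`, each amplified by at most
  -- `e^{3L}`, so the total is of order `1 / n`.
  have main : ∀ n : ℕ, 0 < n → (L : ℝ) ≤ n →
      d r ≤ C * (L : ℝ) ^ 2 * Real.exp (3 * L) / n := by
    intro n hn hLn
    have hn' : (0 : ℝ) < n := Nat.cast_pos.2 hn
    set δ : ℝ≥0 := L / n with hδ
    have hδn : (n : ℝ≥0) * δ = L := by
      rw [hδ]
      field_simp
    have hδr : (δ : ℝ) = L / n := by simp [hδ]
    have hδ1 : (δ : ℝ) ≤ 1 := by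
      rw [hδr, div_le_one hn']
      exact hLn
    have ind : ∀ k : ℕ, k ≤ n →
        d (t + k * δ) ≤ k * (C * (δ : ℝ) ^ 2) * Real.exp (3 * (k * δ)) := by
      intro k
      induction k with
      | zero =>
        intro _
        simp [h0]
      | succ k ih =>
        intro hk
        have ih' := ih ((Nat.le_succ k).trans hk)
        have hle : t + ((k + 1 : ℕ) : ℝ≥0) * δ ≤ T := by
          refine le_trans ?_ hr.2
          rw [← hLr, ← hδn]
          gcongr
        have hdiff : ((t + ((k + 1 : ℕ) : ℝ≥0) * δ : ℝ≥0) : ℝ) - ((t + k * δ : ℝ≥0) : ℝ) = δ := by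
          push_cast
          ring
        have hs := hstep (t + k * δ) (t + ((k + 1 : ℕ) : ℝ≥0) * δ) le_self_add
          (by gcongr; exact Nat.le_succ k) hle (by rw [hdiff]; exact hδ1)
        rw [hdiff] at hs
        have hexp : 1 + 3 * (δ : ℝ) ≤ Real.exp (3 * δ) := by
          have := Real.add_one_le_exp (3 * (δ : ℝ))
          linarith
        have hsum : Real.exp (3 * (((k + 1 : ℕ) : ℝ) * δ))
            = Real.exp (3 * δ) * Real.exp (3 * (k * δ)) := by
          rw [← Real.exp_add]
          congr 1
          push_cast
          ring
        have hone : 1 ≤ Real.exp (3 * (((k + 1 : ℕ) : ℝ) * δ)) :=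
          Real.one_le_exp (by positivity)
        have hA : 0 ≤ C * (δ : ℝ) ^ 2 := by positivity
        calc d (t + ((k + 1 : ℕ) : ℝ≥0) * δ)
            ≤ (1 + 3 * (δ : ℝ)) * d (t + k * δ) + C * (δ : ℝ) ^ 2 := hs
          _ ≤ Real.exp (3 * δ) * (k * (C * (δ : ℝ) ^ 2) * Real.exp (3 * (k * δ)))
              + C * (δ : ℝ) ^ 2 * Real.exp (3 * (((k + 1 : ℕ) : ℝ) * δ)) := by
            exact add_le_add (mul_le_mul hexp ih' (hd _) (Real.exp_nonneg _))
              (le_mul_of_one_le_right hA hone)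
          _ = _ := by
            rw [hsum]
            push_cast
            ring
    have hfin := ind n le_rfl
    rw [hδn, hLr, hδr] at hfin
    refine hfin.trans_eq ?_
    field_simp
  refine le_antisymm ?_ (hd r)
  have lim : Tendsto (fun n : ℕ => C * (L : ℝ) ^ 2 * Real.exp (3 * L) / n) atTop (𝓝 0) :=
    tendsto_const_div_atTop_nhds_zero_nat _
  refine ge_of_tendsto lim ?_
  obtain ⟨N, hN⟩ := exists_nat_ge (L : ℝ)
  filter_upwards [eventually_ge_atTop (N + 1)] with n hn
  refine main n (by omega) (hN.trans ?_)
  exact_mod_cast (by omega : N ≤ n)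

/-! ### Identification of the price with the stochastic exponential -/

section Exponential

variable {Ω : Type*} {W : ℝ≥0 → Ω → ℝ} {t : ℝ≥0}

/-- The stochastic exponential of the Brownian motion started at time `t`. -/
noncomputable def stochExp (W : ℝ≥0 → Ω → ℝ) (t r : ℝ≥0) (ω : Ω) : ℝ :=
  Real.exp (W r ω - W t ω - ((r : ℝ) - t) / 2)

lemma stochExp_eq_add {s r : ℝ≥0} (hsr : s ≤ r) (ω : Ω) :
    stochExp W t r ω = stochExp W t s ω + stochExp W t s ω * (W r ω - W s ω)
      + stochExp W t s ω * expRemainder (r - s : ℝ≥0) (W r ω - W s ω) := by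
  have e : stochExp W t r ω
      = stochExp W t s ω * Real.exp (W r ω - W s ω - ((r - s : ℝ≥0) : ℝ) / 2) := by
    rw [stochExp, stochExp, ← Real.exp_add, NNReal.coe_sub hsr]
    congr 1
    ring
  rw [e, expRemainder]
  ring

variable [mΩ : MeasurableSpace Ω] {P : Measure Ω} {hW : ∀ s, Measurable (W s)} {T : ℝ≥0} {x : ℝ}
  {X : ℝ≥0 → Ω → ℝ}

lemma memLp_comp_increment (hB : IsPreBrownianReal W P) {u v : ℝ≥0} (huv : u ≤ v) {f : ℝ → ℝ}
    (hf : MemLp f 2 (gaussianReal 0 (v - u))) :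
    MemLp (fun ω => f (W v ω - W u ω)) 2 P := by
  have h := hasLaw_increment hB huv
  rw [← h.map_eq] at hf
  exact hf.comp_of_map h.aemeasurable

lemma integral_comp_increment (hB : IsPreBrownianReal W P) {u v : ℝ≥0} (huv : u ≤ v) {f : ℝ → ℝ}
    (hf : Measurable f) :
    ∫ ω, f (W v ω - W u ω) ∂P = ∫ y, f y ∂(gaussianReal 0 (v - u)) := by
  have h := hasLaw_increment hB huv
  rw [← h.map_eq, integral_map h.aemeasurable hf.aestronglyMeasurable]

lemma stronglyMeasurable_stochExp {r : ℝ≥0} (htr : t ≤ r) :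
    StronglyMeasurable[augFiltration P W hW r] (stochExp W t r) := by
  have h1 : Measurable[augFiltration P W hW r] (W r) := measurable_augFiltration le_rfl
  have h2 : Measurable[augFiltration P W hW r] (W t) := measurable_augFiltration htr
  exact (Real.measurable_exp.comp ((h1.sub h2).sub_const _)).stronglyMeasurable

lemma memLp_stochExp (hB : IsPreBrownianReal W P) {r : ℝ≥0} (htr : t ≤ r) :
    MemLp (stochExp W t r) 2 P := by
  have h := memLp_comp_increment hB htr (memLp_exp_gaussianReal (-(((r : ℝ) - t) / 2)))
  refine h.ae_eq (ae_of_all _ fun ω => ?_)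
  simp only [stochExp, sub_eq_add_neg]

lemma integral_stochExp_sq (hB : IsPreBrownianReal W P) {r : ℝ≥0} (htr : t ≤ r) :
    ∫ ω, stochExp W t r ω ^ 2 ∂P = Real.exp ((r : ℝ) - t) := by
  have e : ∀ ω, stochExp W t r ω ^ 2 = Real.exp (2 * (W r ω - W t ω) + -((r : ℝ) - t)) := fun ω => by
    rw [stochExp, ← Real.exp_nat_mul]
    congr 1
    push_cast
    ring
  simp_rw [e]
  rw [integral_comp_increment hB htr (f := fun y => Real.exp (2 * y + -((r : ℝ) - t)))
    (by fun_prop), integral_exp_gaussianReal, NNReal.coe_sub htr]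
  congr 1
  ring

lemma measurable_expRemainder (δ : ℝ) : Measurable (expRemainder δ) := by
  unfold expRemainder
  fun_prop

namespace IsRegularPrice

variable [IsProbabilityMeasure P]

/-- The difference `D` at time `s` changes over the step by some `B` orthogonal to `D`, so the mean
squares add. Without orthogonality the cross term would leave errors of order `r - s`, which do not
vanish after summation. -/
lemma integral_sub_stochExp_sq_le (hB : IsPreBrownianReal W P)
    (hX : IsRegularPrice P W hW t T x X) {C : ℝ} (hC : ∀ r ∈ Icc t T, ∫ ω, X r ω ^ 2 ∂P ≤ C)
    {s r : ℝ≥0} (hts : t ≤ s) (hsr : s ≤ r) (hrT : r ≤ T) (hδ1 : (r : ℝ) - s ≤ 1) :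
    ∫ ω, (X r ω - x * stochExp W t r ω) ^ 2 ∂P
      ≤ (1 + 3 * ((r : ℝ) - s)) * (∫ ω, (X s ω - x * stochExp W t s ω) ^ 2 ∂P)
        + 3 * (C + x ^ 2 * Real.exp T) * ((r : ℝ) - s) ^ 2 := by
  have hs : s ∈ Icc t T := ⟨hts, hsr.trans hrT⟩
  have hr : r ∈ Icc t T := ⟨hts.trans hsr, hrT⟩
  set ΔW : Ω → ℝ := fun ω => W r ω - W s ω with hΔW
  set D : Ω → ℝ := fun ω => X s ω - x * stochExp W t s ω with hD
  set ε : Ω → ℝ := fun ω => X r ω - X s ω - X s ω * (W r ω - W s ω) with hε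
  set ρ : Ω → ℝ := fun ω => expRemainder (r - s : ℝ≥0) (W r ω - W s ω) with hρ
  set η : Ω → ℝ := fun ω => stochExp W t s ω * ρ ω with hη
  have hEm := stronglyMeasurable_stochExp (P := P) (hW := hW) hts
  have hE2 := memLp_stochExp hB hts
  have hDm : StronglyMeasurable[augFiltration P W hW s] D :=
    (hX.adapted s hs).sub (hEm.const_mul x)
  have hD2 : MemLp D 2 P := (hX.memLp hs).sub (hE2.const_mul x)
  obtain ⟨hε2, hεC⟩ := hX.integral_euler_error_sq_le hB hC hts hsr hrT
  have hρ2 : MemLp ρ 2 P := memLp_comp_increment hB hsr memLp_expRemainder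
  have hind : ∀ {Y : Ω → ℝ}, StronglyMeasurable[augFiltration P W hW s] Y → IndepFun Y ρ P :=
    fun hY => (indepFun_increment hB hsr hY).comp measurable_id (measurable_expRemainder _)
  have hρ0 : ∫ ω, ρ ω ∂P = 0 := by
    rw [hρ, integral_comp_increment hB hsr (measurable_expRemainder _), integral_expRemainder]
  have hδ : ((r - s : ℝ≥0) : ℝ) = r - s := NNReal.coe_sub hsr
  have hδ0 : (0 : ℝ) ≤ r - s := sub_nonneg.2 (NNReal.coe_le_coe.2 hsr)
  have hρC : ∫ ω, ρ ω ^ 2 ∂P ≤ ((r : ℝ) - s) ^ 2 := by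
    rw [hρ, integral_comp_increment hB hsr (f := fun y => expRemainder (r - s : ℝ≥0) y ^ 2)
      ((measurable_expRemainder _).pow_const 2), ← hδ]
    refine integral_expRemainder_sq_le ?_
    rw [← NNReal.coe_le_coe, hδ]
    exact hδ1
  have hη2 : MemLp η 2 P := memLp_mul_of_indepFun (hind hEm) hE2 hρ2
  have hηC : ∫ ω, η ω ^ 2 ∂P ≤ Real.exp T * ((r : ℝ) - s) ^ 2 := by
    rw [integral_mul_sq_of_indepFun (hind hEm) hE2 hρ2, integral_stochExp_sq hB hts]
    have : (s : ℝ) - t ≤ T := by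
      have h1 : (s : ℝ) ≤ T := hs.2
      have h2 := t.coe_nonneg
      linarith
    have h3 : 0 ≤ ∫ ω, ρ ω ^ 2 ∂P := integral_nonneg fun ω => sq_nonneg _
    gcongr
  have hDW2 : MemLp (fun ω => D ω * ΔW ω) 2 P := memLp_mul_increment hB hsr hDm hD2
  have hDWC : ∫ ω, (D ω * ΔW ω) ^ 2 ∂P = (∫ ω, D ω ^ 2 ∂P) * ((r : ℝ) - s) := by
    rw [integral_mul_sq_of_indepFun (indepFun_increment hB hsr hDm) hD2 (memLp_increment hB hsr),
      integral_increment_sq hB hsr]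
  set B : Ω → ℝ := fun ω => D ω * ΔW ω + ε ω - x * η ω with hBdef
  have hB2 : MemLp B 2 P := (hDW2.add hε2).sub (hη2.const_mul x)
  have hdec : ∀ ω, X r ω - x * stochExp W t r ω = D ω + B ω := fun ω => by
    rw [stochExp_eq_add hsr]
    simp only [hBdef, hD, hε, hη, hρ, hΔW]
    ring
  have horth : ∫ ω, D ω * B ω ∂P = 0 := by
    -- As `D = X_s - x E_s` with `E` the exponential, `B = (X_r - X_s) - x E_s (ΔW + ρ)`. The first
    -- term is a martingale increment; `ΔW` and `ρ` are centred and independent of `F_s`. The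
    -- product `D E_s` is only integrable, so integrability of the last two terms also comes from
    -- independence.
    have e : ∀ ω, D ω * B ω = D ω * (X r ω - X s ω)
        - (x * ((D ω * stochExp W t s ω) * ΔW ω) + x * ((D ω * stochExp W t s ω) * ρ ω)) :=
      fun ω => by
        simp only [hBdef, hε, hη, hΔW, hD]
        ring
    have hDE := hDm.mul hEm
    have hDEi : Integrable (fun ω => D ω * stochExp W t s ω) P := integrable_fun_mul hD2 hE2
    have i1 : Integrable (fun ω => D ω * (X r ω - X s ω)) P :=
      integrable_fun_mul hD2 ((hX.memLp hr).sub (hX.memLp hs))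
    have i2 : Integrable (fun ω => x * ((D ω * stochExp W t s ω) * ΔW ω)) P :=
      ((indepFun_increment hB hsr hDE).integrable_mul hDEi
        ((memLp_increment hB hsr).integrable one_le_two)).const_mul x
    have i3 : Integrable (fun ω => x * ((D ω * stochExp W t s ω) * ρ ω)) P :=
      ((hind hDE).integrable_mul hDEi (hρ2.integrable one_le_two)).const_mul x
    simp_rw [e]
    have z2 : ∫ ω, (D ω * stochExp W t s ω) * ΔW ω ∂P = 0 := integral_mul_increment hB hsr hDE
    have z3 : ∫ ω, (D ω * stochExp W t s ω) * ρ ω ∂P = 0 := by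
      have := (hind hDE).integral_fun_mul_eq_mul_integral hDEi.1 hρ2.1
      rw [hρ0, mul_zero] at this
      exact this
    rw [integral_sub i1 (i2.fun_add i3), integral_add i2 i3, integral_const_mul,
      integral_const_mul, z2, z3, hX.integral_mul_sub_eq_zero hB hts hsr hrT hDm hD2]
    simp
  have hBC : ∫ ω, B ω ^ 2 ∂P ≤ 3 * ((∫ ω, D ω ^ 2 ∂P) * ((r : ℝ) - s))
      + 3 * (C * ((r : ℝ) - s) ^ 2) + 3 * x ^ 2 * (Real.exp T * ((r : ℝ) - s) ^ 2) := by
    have j1 := hDW2.integrable_sq.const_mul 3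
    have j2 := hε2.integrable_sq.const_mul 3
    have j3 := hη2.integrable_sq.const_mul (3 * x ^ 2)
    calc ∫ ω, B ω ^ 2 ∂P
        ≤ ∫ ω, (3 * (D ω * ΔW ω) ^ 2 + 3 * ε ω ^ 2 + 3 * x ^ 2 * η ω ^ 2) ∂P := by
          refine integral_mono hB2.integrable_sq ((j1.fun_add j2).fun_add j3) fun ω => ?_
          simp only [hBdef]
          nlinarith [sq_nonneg (D ω * ΔW ω - ε ω), sq_nonneg (D ω * ΔW ω + x * η ω),
            sq_nonneg (ε ω + x * η ω)]
      _ = 3 * ((∫ ω, D ω ^ 2 ∂P) * ((r : ℝ) - s)) + 3 * (∫ ω, ε ω ^ 2 ∂P)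
          + 3 * x ^ 2 * ∫ ω, η ω ^ 2 ∂P := by
          rw [integral_add (j1.fun_add j2) j3, integral_add j1 j2, integral_const_mul,
            integral_const_mul, integral_const_mul, hDWC]
      _ ≤ _ := by gcongr
  have hsum : ∫ ω, (X r ω - x * stochExp W t r ω) ^ 2 ∂P
      = (∫ ω, D ω ^ 2 ∂P) + ∫ ω, B ω ^ 2 ∂P := by
    have e : ∀ ω, (X r ω - x * stochExp W t r ω) ^ 2 = D ω ^ 2 + 2 * (D ω * B ω) + B ω ^ 2 :=
      fun ω => by
        rw [hdec]
        ring
    have j := (integrable_fun_mul hD2 hB2).const_mul 2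
    simp_rw [e]
    rw [integral_add (hD2.integrable_sq.fun_add j) hB2.integrable_sq,
      integral_add hD2.integrable_sq j, integral_const_mul, horth]
    ring
  rw [hsum]
  nlinarith [hBC]

/-- The price is the stochastic exponential. -/
theorem ae_eq_stochExp (hB : IsPreBrownianReal W P) (hX : IsRegularPrice P W hW t T x X)
    {r : ℝ≥0} (hr : r ∈ Icc t T) : ∀ᵐ ω ∂P, X r ω = x * stochExp W t r ω := by
  have htT := hr.1.trans hr.2
  obtain ⟨C, hC0, hC⟩ := hX.exists_integral_sq_le hB htT
  have h0 : ∫ ω, (X t ω - x * stochExp W t t ω) ^ 2 ∂P = 0 := by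
    rw [← integral_zero Ω ℝ (μ := P)]
    refine integral_congr_ae ?_
    filter_upwards [hX.ae_eq_initial hB htT] with ω hω
    simp [hω, stochExp]
  have hz := eq_zero_of_quadratic_growth
    (d := fun r => ∫ ω, (X r ω - x * stochExp W t r ω) ^ 2 ∂P) (t := t) (T := T)
    (C := 3 * (C + x ^ 2 * Real.exp T)) (by positivity)
    (fun r => integral_nonneg fun ω => sq_nonneg _) h0
    (fun s r hts hsr hrT h1 => hX.integral_sub_stochExp_sq_le hB hC hts hsr hrT h1) hr
  have hm := (hX.memLp hr).sub ((memLp_stochExp hB hr.1).const_mul x)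
  have := (integral_eq_zero_iff_of_nonneg (fun ω => sq_nonneg _) hm.integrable_sq).1 hz
  filter_upwards [this] with ω hω
  have := pow_eq_zero_iff (two_ne_zero) |>.1 hω
  simpa [sub_eq_zero] using this

theorem ae_pos (hB : IsPreBrownianReal W P) (hX : IsRegularPrice P W hW t T x X) (hx : 0 < x)
    {r : ℝ≥0} (hr : r ∈ Icc t T) : ∀ᵐ ω ∂P, 0 < X r ω := by
  filter_upwards [hX.ae_eq_stochExp hB hr] with ω hω
  rw [hω]
  exact mul_pos hx (Real.exp_pos _)

end IsRegularPrice

end Exponential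

/-! ### Inventory and liquidation time along a path -/

section Path

variable {t T : ℝ≥0} {cmax : ℝ} {p : ℝ≥0 → ℝ}

lemma toNNReal_le_of_mem_Ioc {a b : ℝ≥0} {s : ℝ} (hs : s ∈ Ioc (a : ℝ) b) : s.toNNReal ≤ b :=
  (mem_Ioc_toNNReal hs).2

/-- Progressive measurability says nothing after `T`, so path measurability is assumed only for the
path frozen at `T`. -/
lemma aestronglyMeasurable_path {a b : ℝ≥0} (hbT : b ≤ T)
    (hm : StronglyMeasurable fun s => p (min s T)) :
    AEStronglyMeasurable (fun s : ℝ => p s.toNNReal) (volume.restrict (Ioc (a : ℝ) b)) := by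
  have h1 : StronglyMeasurable fun s : ℝ => p (min s.toNNReal T) :=
    hm.comp_measurable (g := fun s : ℝ => s.toNNReal) (by fun_prop)
  refine h1.aestronglyMeasurable.congr ?_
  filter_upwards [ae_restrict_mem measurableSet_Ioc] with s hs
  rw [min_eq_left ((toNNReal_le_of_mem_Ioc hs).trans hbT)]

lemma intervalIntegrable_path_mul {a b : ℝ≥0} (hab : a ≤ b) (hbT : b ≤ T)
    (hm : StronglyMeasurable fun s => p (min s T)) (hp : ∀ r ≤ T, p r ∈ Icc 0 cmax) {y : ℝ≥0 → ℝ}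
    (hy : ContinuousOn y (Icc a b)) :
    IntervalIntegrable (fun s : ℝ => p s.toNNReal * y s.toNNReal) volume a b := by
  have hab' : (a : ℝ) ≤ b := hab
  have hy' : ContinuousOn (fun s : ℝ => y s.toNNReal) (Icc (a : ℝ) b) := by
    refine hy.comp continuous_real_toNNReal.continuousOn fun s hs => ?_
    exact ⟨NNReal.le_toNNReal_of_coe_le hs.1, Real.toNNReal_le_iff_le_coe.2 hs.2⟩
  rw [intervalIntegrable_iff_integrableOn_Ioc_of_le hab']
  refine Integrable.bdd_mul (c := cmax)
    ((hy'.integrableOn_Icc).mono_set Ioc_subset_Icc_self) (aestronglyMeasurable_path hbT hm) ?_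
  filter_upwards [ae_restrict_mem measurableSet_Ioc] with s hs
  have := hp _ ((toNNReal_le_of_mem_Ioc hs).trans hbT)
  rw [Real.norm_of_nonneg this.1]
  exact this.2

lemma intervalIntegrable_path {a b : ℝ≥0} (hab : a ≤ b) (hbT : b ≤ T)
    (hm : StronglyMeasurable fun s => p (min s T)) (hp : ∀ r ≤ T, p r ∈ Icc 0 cmax) :
    IntervalIntegrable (fun s : ℝ => p s.toNNReal) volume a b := by
  simpa using intervalIntegrable_path_mul hab hbT hm hp (y := fun _ => 1) continuousOn_const

lemma continuousOn_timeIntegral (htT : t ≤ T) (hm : StronglyMeasurable fun s => p (min s T))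
    (hp : ∀ r ≤ T, p r ∈ Icc 0 cmax) :
    ContinuousOn (fun r => timeIntegral t r p) (Icc t T) := by
  have htT' : (t : ℝ) ≤ T := htT
  have h := intervalIntegral.continuousOn_primitive_interval'
    (intervalIntegrable_path htT le_rfl hm hp) (left_mem_uIcc)
  rw [uIcc_of_le htT'] at h
  exact h.comp NNReal.continuous_coe.continuousOn fun r hr => ⟨hr.1, hr.2⟩

lemma timeIntegral_mono (hm : StronglyMeasurable fun s => p (min s T))
    (hp : ∀ r ≤ T, p r ∈ Icc 0 cmax) {r s : ℝ≥0} (htr : t ≤ r) (hrs : r ≤ s) (hsT : s ≤ T) :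
    timeIntegral t r p ≤ timeIntegral t s p := by
  have h1 := intervalIntegrable_path htr (hrs.trans hsT) hm hp
  have h2 := intervalIntegrable_path hrs hsT hm hp
  rw [timeIntegral, timeIntegral, ← intervalIntegral.integral_add_adjacent_intervals h1 h2]
  have : 0 ≤ ∫ u in (r : ℝ)..s, p u.toNNReal :=
    intervalIntegral.integral_nonneg (NNReal.coe_le_coe.2 hrs) fun u hu =>
      (hp _ ((Real.toNNReal_le_iff_le_coe.2 hu.2).trans hsT)).1
  linarith

variable {Ω : Type*} {π : ℝ≥0 → Ω → ℝ} {q : ℝ} {ω : Ω}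

lemma liquidationTime_le : liquidationTime t T q π ω ≤ T :=
  csInf_le (OrderBot.bddBelow _) (mem_insert _ _)

lemma liquidationTime_le_of_inventory_eq_zero {r : ℝ≥0} (htr : t ≤ r)
    (h : inventory t q π r ω = 0) : liquidationTime t T q π ω ≤ r :=
  csInf_le (OrderBot.bddBelow _) (mem_insert_of_mem _ ⟨htr, h⟩)

lemma le_liquidationTime {s : ℝ≥0} (hsT : s ≤ T)
    (h : ∀ r, t ≤ r → inventory t q π r ω = 0 → s ≤ r) : s ≤ liquidationTime t T q π ω := by
  refine le_csInf (insert_nonempty _ _) ?_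
  rintro r (rfl | ⟨h1, h2⟩)
  · exact hsT
  · exact h r h1 h2

lemma start_le_liquidationTime (htT : t ≤ T) : t ≤ liquidationTime t T q π ω :=
  le_liquidationTime htT fun _ h _ => h

variable (hm : StronglyMeasurable fun s => π (min s T) ω)
  (hp : ∀ r ≤ T, π r ω ∈ Icc 0 cmax)

include hm hp

lemma exists_inventory_eq_zero (hq : 0 < q) {s : ℝ≥0} (hts : t ≤ s) (hsT : s ≤ T)
    (h : inventory t q π s ω ≤ 0) : ∃ r ∈ Icc t s, inventory t q π r ω = 0 := by
  have hc : ContinuousOn (fun r => inventory t q π r ω) (Icc t s) :=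
    continuousOn_const.sub
      ((continuousOn_timeIntegral (hts.trans hsT) hm hp).mono (Icc_subset_Icc_right hsT))
  have ht : inventory t q π t ω = q := by simp [inventory, timeIntegral]
  obtain ⟨r, hr, h0⟩ := intermediate_value_Icc' hts hc ⟨h, by simpa only [ht] using hq.le⟩
  exact ⟨r, hr, h0⟩

/-- Together with `le_of_inventory_pos`, this identifies the times before liquidation, up to one
instant, with those of positive inventory. -/
lemma inventory_pos_of_lt (hq : 0 < q) {s : ℝ≥0} (hts : t ≤ s)
    (h : s < liquidationTime t T q π ω) : 0 < inventory t q π s ω := by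
  by_contra hn
  obtain ⟨r, hr, h0⟩ := exists_inventory_eq_zero hm hp hq hts (h.le.trans liquidationTime_le)
    (not_lt.1 hn)
  exact absurd h (not_lt.2 ((liquidationTime_le_of_inventory_eq_zero hr.1 h0).trans hr.2))

lemma le_of_inventory_pos {s : ℝ≥0} (hsT : s ≤ T)
    (h : 0 < inventory t q π s ω) : s ≤ liquidationTime t T q π ω := by
  refine le_liquidationTime hsT fun r htr h0 => ?_
  by_contra hn
  have := timeIntegral_mono (p := fun s => π s ω) hm hp htr (not_le.1 hn).le hsT
  simp only [inventory] at h h0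
  linarith

/-- A negative inventory would, by continuity, be preceded by a zero; minimality puts that zero at
the liquidation time itself, a contradiction. -/
lemma inventory_liquidationTime_nonneg (htT : t ≤ T) (hq : 0 < q) :
    0 ≤ inventory t q π (liquidationTime t T q π ω) ω := by
  by_contra hn
  obtain ⟨r, hr, h0⟩ := exists_inventory_eq_zero hm hp hq (start_le_liquidationTime htT)
    liquidationTime_le (not_le.1 hn).le
  have := le_antisymm hr.2 (liquidationTime_le_of_inventory_eq_zero hr.1 h0)
  rw [this] at h0
  exact hn h0.ge

omit hm hp

/-- The control stopped when the inventory is exhausted. -/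
noncomputable def stoppedControl (t : ℝ≥0) (q : ℝ) (π : ℝ≥0 → Ω → ℝ) (s : ℝ≥0) (ω : Ω) : ℝ :=
  {ω | 0 < inventory t q π s ω}.indicator (π s) ω

lemma stoppedControl_mem (hp : ∀ r ≤ T, π r ω ∈ Icc 0 cmax) {s : ℝ≥0} (hs : s ≤ T) :
    stoppedControl t q π s ω ∈ Icc 0 cmax := by
  have := hp s hs
  by_cases h : 0 < inventory t q π s ω
  · simpa [stoppedControl, h] using this
  · simpa [stoppedControl, h] using this.1.trans this.2

include hm hp

/-- Integrals up to the liquidation time in terms of the stopped control. -/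
lemma timeIntegral_liquidationTime_eq (htT : t ≤ T) (hq : 0 < q) (y : ℝ≥0 → ℝ) :
    timeIntegral t (liquidationTime t T q π ω) (fun s => π s ω * y s)
      = ∫ s : ℝ, timeRestrict t T (stoppedControl t q π) (s, ω) * y s.toNNReal := by
  have h1 : (t : ℝ) ≤ liquidationTime t T q π ω :=
    NNReal.coe_le_coe.2 (start_le_liquidationTime htT)
  rw [timeIntegral, intervalIntegral.integral_of_le h1, ← integral_indicator measurableSet_Ioc]
  refine integral_congr_ae ?_
  -- At the liquidation time itself the inventory may be zero or positive; this single instant is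
  -- discarded.
  have hne : ∀ᵐ s : ℝ, s ≠ liquidationTime t T q π ω := by simp [ae_iff]
  filter_upwards [hne] with s hs
  by_cases h2 : s ∈ Ioc (t : ℝ) T
  · have h3 := mem_Ioc_toNNReal h2
    have hs' : (s.toNNReal : ℝ) = s := Real.coe_toNNReal s (t.coe_nonneg.trans h2.1.le)
    rcases lt_or_gt_of_ne hs with h | h
    · have h4 : s.toNNReal < liquidationTime t T q π ω := by
        rw [← NNReal.coe_lt_coe, hs']
        exact h
      have h5 := inventory_pos_of_lt hm hp hq h3.1.le h4
      have h6 : s ∈ Ioc (t : ℝ) (liquidationTime t T q π ω) := ⟨h2.1, h.le⟩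
      simp [timeRestrict, h2, h6, stoppedControl, h5]
    · have h5 : ¬ 0 < inventory t q π s.toNNReal ω := fun h5 => by
        have := le_of_inventory_pos hm hp h3.2 h5
        rw [← NNReal.coe_le_coe, hs'] at this
        exact absurd h (not_lt.2 this)
      have h6 : s ∉ Ioc (t : ℝ) (liquidationTime t T q π ω) := fun h6 => absurd h (not_lt.2 h6.2)
      rw [indicator_of_notMem h6]
      simp [timeRestrict, h2, stoppedControl, h5]
  · have h6 : s ∉ Ioc (t : ℝ) (liquidationTime t T q π ω) := fun h6 =>
      h2 ⟨h6.1, h6.2.trans (NNReal.coe_le_coe.2 liquidationTime_le)⟩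
    rw [indicator_of_notMem h6]
    simp [timeRestrict, h2]

lemma timeIntegral_liquidationTime_le (htT : t ≤ T) (hq : 0 < q) :
    timeIntegral t (liquidationTime t T q π ω) (fun s => π s ω) ≤ q :=
  sub_nonneg.1 (inventory_liquidationTime_nonneg hm hp htT hq)

lemma timeIntegral_liquidationTime_le_mul (htT : t ≤ T) (hcmax : 0 ≤ cmax) :
    timeIntegral t (liquidationTime t T q π ω) (fun s => π s ω) ≤ cmax * ((T : ℝ) - t) := by
  have h1 : (t : ℝ) ≤ liquidationTime t T q π ω :=
    NNReal.coe_le_coe.2 (start_le_liquidationTime htT)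
  have h2 : (liquidationTime t T q π ω : ℝ) ≤ T := NNReal.coe_le_coe.2 liquidationTime_le
  have h3 := intervalIntegral.integral_mono_on h1
    (intervalIntegrable_path (start_le_liquidationTime (q := q) (π := π) (ω := ω) htT)
      liquidationTime_le hm hp)
    (intervalIntegrable_const (c := cmax)) fun s hs =>
      (hp _ ((Real.toNNReal_le_iff_le_coe.2 hs.2).trans liquidationTime_le)).2
  rw [intervalIntegral.integral_const, smul_eq_mul, mul_comm] at h3
  refine h3.trans ?_
  gcongr

end Path

/-! ### Measurability of controls -/

section Measurability

variable {Ω : Type*} {T : ℝ≥0} {φ : ℝ≥0 → Ω → ℝ}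

lemma stronglyMeasurable_min {m : MeasurableSpace Ω}
    (h : StronglyMeasurable fun p : Iic T × Ω => φ p.1 p.2) :
    StronglyMeasurable fun p : ℝ≥0 × Ω => φ (min p.1 T) p.2 :=
  h.comp_measurable (g := fun p : ℝ≥0 × Ω => ((⟨min p.1 T, mem_Iic.2 (min_le_right _ _)⟩ : Iic T), p.2))
    (((measurable_fst.min measurable_const).subtype_mk).prodMk measurable_snd)

lemma stronglyMeasurable_timeIntegral {m : MeasurableSpace Ω}
    (h : StronglyMeasurable fun p : Iic T × Ω => φ p.1 p.2) {a : ℝ≥0} (haT : a ≤ T) :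
    StronglyMeasurable fun ω => timeIntegral a T fun s => φ s ω := by
  have h1 : StronglyMeasurable (Function.uncurry fun (s : ℝ) ω => φ (min s.toNNReal T) ω) :=
    (stronglyMeasurable_min h).comp_measurable (g := fun p : ℝ × Ω => (p.1.toNNReal, p.2))
      (by fun_prop)
  have h2 := h1.integral_prod_left (μ := volume.restrict (Ioc (a : ℝ) T))
  convert! h2 using 1
  ext ω
  rw [timeIntegral, intervalIntegral.integral_of_le (NNReal.coe_le_coe.2 haT)]
  refine setIntegral_congr_fun measurableSet_Ioc fun s hs => ?_
  simp only [min_eq_left (toNNReal_le_of_mem_Ioc hs)]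

lemma stronglyMeasurable_section {m : MeasurableSpace Ω}
    (h : StronglyMeasurable fun p : Iic T × Ω => φ p.1 p.2) : StronglyMeasurable (φ T) :=
  h.comp_measurable (g := fun ω => ((⟨T, self_mem_Iic⟩ : Iic T), ω))
    (measurable_const.prodMk measurable_id)

variable [mΩ : MeasurableSpace Ω]

lemma ProgressiveUpTo.stronglyMeasurable {F : Filtration ℝ≥0 mΩ} (h : ProgressiveUpTo F T φ) :
    StronglyMeasurable fun p : Iic T × Ω => φ p.1 p.2 :=
  (h T le_rfl).mono (sup_le_sup le_rfl (MeasurableSpace.comap_mono (F.le T)))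

variable {F : Filtration ℝ≥0 mΩ} {π : ℝ≥0 → Ω → ℝ} {t : ℝ≥0} {q : ℝ}

lemma ProgressiveUpTo.stronglyMeasurable_inventory (h : ProgressiveUpTo F T π) {s : ℝ≥0}
    (hs : s ∈ Icc t T) : StronglyMeasurable[F s] (inventory t q π s) :=
  stronglyMeasurable_const.sub (stronglyMeasurable_timeIntegral (h s hs.2) hs.1)

/-- The stopping rule reads only the current inventory, so the liquidation time need not be shown to
be a stopping time. -/
lemma ProgressiveUpTo.stronglyMeasurable_stoppedControl (h : ProgressiveUpTo F T π) {s : ℝ≥0}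
    (hs : s ∈ Icc t T) : StronglyMeasurable[F s] (stoppedControl t q π s) :=
  (stronglyMeasurable_section (h s hs.2)).indicator
    ((h.stronglyMeasurable_inventory hs).measurable measurableSet_Ioi)

lemma ProgressiveUpTo.path (h : ProgressiveUpTo F T π) (ω : Ω) :
    StronglyMeasurable fun s => π (min s T) ω :=
  (stronglyMeasurable_min h.stronglyMeasurable).comp_measurable (g := fun s : ℝ≥0 => (s, ω))
    (by fun_prop)

lemma ProgressiveUpTo.stronglyMeasurable_timeRestrict (h : ProgressiveUpTo F T π) (a : ℝ≥0) {b : ℝ≥0}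
    (hb : b ≤ T) : StronglyMeasurable (timeRestrict a b π) := by
  have h1 := Liquidation.stronglyMeasurable_timeRestrict a b
    (g := fun s ω => π (min s T) ω) (stronglyMeasurable_min h.stronglyMeasurable)
  convert! h1 using 1
  ext p
  refine timeRestrict_congr fun s hs => ?_
  rw [min_eq_left (hs.2.trans hb)]

/-- The inventory is continuous in time and measurable in the scenario, hence jointly measurable,
and so is the event that it is positive. -/
lemma stronglyMeasurable_timeRestrict_stoppedControl {cmax : ℝ} (htT : t ≤ T)
    (h : ProgressiveUpTo F T π) (hp : ∀ r ≤ T, ∀ ω, π r ω ∈ Icc 0 cmax) :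
    StronglyMeasurable (timeRestrict t T (stoppedControl t q π)) := by
  have hmem : ∀ r : ℝ≥0, max t (min r T) ∈ Icc t T := fun r =>
    ⟨le_max_left _ _, max_le htT (min_le_right _ _)⟩
  have hQ : StronglyMeasurable (Function.uncurry
      fun (r : ℝ≥0) (ω : Ω) => inventory t q π (max t (min r T)) ω) := by
    refine stronglyMeasurable_uncurry_of_continuous_of_stronglyMeasurable (fun ω => ?_) fun r => ?_
    · have hc : ContinuousOn (fun r => inventory t q π r ω) (Icc t T) :=
        continuousOn_const.sub
          (continuousOn_timeIntegral htT (h.path ω) fun r hr => hp r hr ω)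
      exact hc.comp_continuous (by fun_prop) hmem
    · exact (h.stronglyMeasurable_inventory (hmem r)).mono (F.le _)
  have h1 := (stronglyMeasurable_min h.stronglyMeasurable).indicator
    (hQ.measurable (measurableSet_Ioi (a := 0)))
  have h2 := Liquidation.stronglyMeasurable_timeRestrict t T (g := fun r ω =>
    {ω | 0 < inventory t q π (max t (min r T)) ω}.indicator (π (min r T)) ω) (by
      convert! h1 using 1)
  convert! h2 using 1
  ext p
  refine timeRestrict_congr fun s hs => ?_
  rw [min_eq_left hs.2, max_eq_right hs.1.le]
  rfl

end Measurability

/-! ### Expected payoffs -/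

section Candidate

variable {Ω : Type*} {t T : ℝ≥0} {x q cmax : ℝ}

/-- Total amount sold up to the liquidation time. -/
noncomputable def amountSold (t T : ℝ≥0) (q : ℝ) (π : ℝ≥0 → Ω → ℝ) (ω : Ω) : ℝ :=
  timeIntegral t (liquidationTime t T q π ω) fun s => π s ω

lemma candidateValue_eq (t T : ℝ) :
    candidateValue t T x q cmax = min q (cmax * (T - t)) * x := by
  rw [candidateValue]
  split_ifs with h
  · rw [min_eq_left h]
  · rw [min_eq_right (not_le.1 h).le]
    ring

lemma candidateRate_mem (htT : t ≤ T) (hq : 0 < q) (hcmax : 0 ≤ cmax) :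
    candidateRate t T q cmax ∈ Icc 0 cmax := by
  rw [candidateRate]
  split_ifs with h
  · have h0 : (0 : ℝ) ≤ T - t := sub_nonneg.2 (NNReal.coe_le_coe.2 htT)
    have h1 : (0 : ℝ) < T - t := by
      rcases h0.eq_or_lt with e | e
      · rw [← e, mul_zero] at h
        exact absurd hq (not_lt.2 h)
      · exact e
    exact ⟨by positivity, (div_le_iff₀ h1).2 h⟩
  · exact ⟨hcmax, le_rfl⟩

lemma candidateRate_mul (hq : 0 < q) (t T : ℝ) :
    candidateRate t T q cmax * (T - t) = min q (cmax * (T - t)) := by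
  rw [candidateRate]
  split_ifs with h
  · have h1 : T - t ≠ 0 := fun e => by
      rw [e, mul_zero] at h
      exact absurd hq (not_lt.2 h)
    rw [min_eq_left h, div_mul_cancel₀ _ h1]
  · rw [min_eq_right (not_le.1 h).le]

lemma timeIntegral_const {a b : ℝ≥0} (k : ℝ) : timeIntegral a b (fun _ => k) = k * ((b : ℝ) - a) := by
  simp [timeIntegral, mul_comm]

/-- A constant rate that sells at most `q` by time `T` cannot exhaust the inventory earlier, so the
liquidation time is `T`. -/
lemma amountSold_const (hq : 0 < q) {k : ℝ} (hk : 0 ≤ k)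
    (hkq : k * ((T : ℝ) - t) ≤ q) (ω : Ω) :
    amountSold t T q (fun _ _ => k) ω = k * ((T : ℝ) - t) := by
  have h : liquidationTime t T q (fun _ _ => k) ω = T := by
    refine le_antisymm liquidationTime_le (le_liquidationTime le_rfl fun r htr h0 => ?_)
    simp only [inventory, timeIntegral_const] at h0
    by_contra hn
    have hn' : (r : ℝ) < T := NNReal.coe_lt_coe.2 (not_le.1 hn)
    rcases hk.eq_or_lt with e | e
    · rw [← e] at h0
      linarith
    · nlinarith
  rw [amountSold, h, timeIntegral_const]

end Candidate

/-! ### Valuation of the sales at the terminal price -/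

section Payoff

variable {Ω : Type*} [mΩ : MeasurableSpace Ω] {P : Measure Ω}
  {W : ℝ≥0 → Ω → ℝ} {hW : ∀ s, Measurable (W s)} {t T : ℝ≥0} {x q cmax : ℝ} {X π : ℝ≥0 → Ω → ℝ}

lemma payoff_eq (htT : t ≤ T) (hq : 0 < q) (hπ : Admissible P (augFiltration P W hW) T cmax π)
    (ω : Ω) : payoff t T q X π ω
      = ∫ s : ℝ, timeRestrict t T (stoppedControl t q π) (s, ω) * timeRestrict t T X (s, ω) := by
  have h := timeIntegral_liquidationTime_eq (hπ.progressive.path ω)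
    (fun r hr => hπ.range r hr ω) htT hq fun s => X s ω
  rw [payoff]
  simp only [runningPayoff]
  rw [h]
  refine integral_congr_ae (ae_of_all _ fun s => ?_)
  by_cases hs : s ∈ Ioc (t : ℝ) T <;> simp [timeRestrict, hs]

lemma amountSold_eq (htT : t ≤ T) (hq : 0 < q) (hπ : Admissible P (augFiltration P W hW) T cmax π)
    (ω : Ω) : amountSold t T q π ω
      = ∫ s : ℝ, timeRestrict t T (stoppedControl t q π) (s, ω) := by
  have h := timeIntegral_liquidationTime_eq (hπ.progressive.path ω)
    (fun r hr => hπ.range r hr ω) htT hq fun _ => 1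
  simpa only [mul_one, amountSold] using h

lemma amountSold_le (htT : t ≤ T) (hq : 0 < q) (hcmax : 0 ≤ cmax)
    (hπ : Admissible P (augFiltration P W hW) T cmax π) (ω : Ω) :
    amountSold t T q π ω ≤ min q (cmax * ((T : ℝ) - t)) :=
  le_min (timeIntegral_liquidationTime_le (hπ.progressive.path ω)
      (fun r hr => hπ.range r hr ω) htT hq)
    (timeIntegral_liquidationTime_le_mul (hπ.progressive.path ω)
      (fun r hr => hπ.range r hr ω) htT hcmax)

variable [IsProbabilityMeasure P]

lemma memLp_timeRestrict_stoppedControl (htT : t ≤ T)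
    (hπ : Admissible P (augFiltration P W hW) T cmax π) :
    MemLp (timeRestrict t T (stoppedControl t q π)) 2 (volume.prod P) := by
  refine (memLp_stepProcess (u := t) (v := T) (memLp_const cmax)).mono
    (stronglyMeasurable_timeRestrict_stoppedControl htT hπ.progressive
      hπ.range).aestronglyMeasurable (ae_of_all _ fun p => ?_)
  by_cases hp : p.1 ∈ Ioc (t : ℝ) T
  · have := stoppedControl_mem (t := t) (q := q) (fun r hr => hπ.range r hr p.2)
      (toNNReal_le_of_mem_Ioc hp)
    simp only [timeRestrict, stepProcess, indicator_of_mem hp]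
    rw [Real.norm_of_nonneg this.1, Real.norm_of_nonneg (this.1.trans this.2)]
    exact this.2
  · simp [timeRestrict, stepProcess, hp]

lemma IsRegularPrice.integrable_payoff (htT : t ≤ T) (hq : 0 < q)
    (hX : IsRegularPrice P W hW t T x X) (hπ : Admissible P (augFiltration P W hW) T cmax π) :
    Integrable (payoff t T q X π) P := by
  have h := integrable_fun_mul (memLp_timeRestrict_stoppedControl (q := q) htT hπ)
    (hX.ito T ⟨htT, le_rfl⟩).memLp_process
  refine h.integral_prod_right.congr (ae_of_all _ fun ω => ?_)
  exact (payoff_eq htT hq hπ ω).symm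

/-- By the martingale property, all sales can be valued at the terminal price. -/
lemma IsRegularPrice.expectedPayoff_eq (hB : IsPreBrownianReal W P) (htT : t ≤ T) (hq : 0 < q)
    (hX : IsRegularPrice P W hW t T x X) (hπ : Admissible P (augFiltration P W hW) T cmax π) :
    Integrable (fun ω => amountSold t T q π ω * X T ω) P ∧
    expectedPayoff P t T q X π = ∫ ω, amountSold t T q π ω * X T ω ∂P := by
  have hψ := memLp_timeRestrict_stoppedControl (q := q) htT hπ
  have hT : T ∈ Icc t T := ⟨htT, le_rfl⟩
  have i1 := integrable_fun_mul hψ (hX.ito T hT).memLp_process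
  have i2 := integrable_fun_mul hψ (memLp_stepProcess (u := t) (v := T) (hX.memLp hT))
  have e : ∀ ω, ∫ s : ℝ, timeRestrict t T (stoppedControl t q π) (s, ω)
      * stepProcess t T (X T) (s, ω) = amountSold t T q π ω * X T ω := fun ω => by
    rw [amountSold_eq htT hq hπ, ← integral_mul_const]
    refine integral_congr_ae (ae_of_all _ fun s => ?_)
    by_cases hs : s ∈ Ioc (t : ℝ) T <;> simp [timeRestrict, stepProcess, hs]
  refine ⟨i2.integral_prod_right.congr (ae_of_all _ e), ?_⟩
  rw [expectedPayoff]
  simp_rw [payoff_eq (X := X) htT hq hπ, ← e]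
  -- Exchanging the integrals leaves an expectation at each fixed time `s`, where the stopped
  -- control is bounded and `F_s`-measurable and the martingale property applies.
  rw [← integral_prod_symm _ i1, ← integral_prod_symm _ i2, integral_prod _ i1, integral_prod _ i2]
  refine integral_congr_ae (ae_of_all _ fun s => ?_)
  by_cases hs : s ∈ Ioc (t : ℝ) T
  · have hs' := mem_Ioc_toNNReal hs
    have hsI : s.toNNReal ∈ Icc t T := ⟨hs'.1.le, hs'.2⟩
    have hm := hπ.progressive.stronglyMeasurable_stoppedControl (q := q) hsI
    simp only [timeRestrict, stepProcess, indicator_of_mem hs]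
    refine hX.integral_mul_eq hB hsI.1 hsI.2 le_rfl hm (MemLp.of_bound
      (stronglyMeasurable_of_augFiltration hm).aestronglyMeasurable cmax (ae_of_all _ fun ω => ?_))
    have := stoppedControl_mem (t := t) (q := q) (fun r hr => hπ.range r hr ω) hsI.2
    rw [Real.norm_of_nonneg this.1]
    exact this.2
  · simp [timeRestrict, hs]

/-- The pathwise bound on the amount sold may be multiplied by `X_T` because the terminal price is
almost surely positive; its mean is `x`. -/
lemma IsRegularPrice.expectedPayoff_le (hB : IsPreBrownianReal W P) (htT : t ≤ T) (hq : 0 < q)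
    (hx : 0 < x) (hcmax : 0 ≤ cmax) (hX : IsRegularPrice P W hW t T x X)
    (hπ : Admissible P (augFiltration P W hW) T cmax π) :
    expectedPayoff P t T q X π ≤ candidateValue t T x q cmax := by
  have hT : T ∈ Icc t T := ⟨htT, le_rfl⟩
  obtain ⟨hi, he⟩ := hX.expectedPayoff_eq hB htT hq hπ
  rw [he, candidateValue_eq, ← hX.integral_eq hB hT, ← integral_const_mul]
  refine integral_mono_ae hi (((hX.memLp hT).integrable one_le_two).const_mul _) ?_
  filter_upwards [hX.ae_pos hB hx hT] with ω hω
  exact mul_le_mul_of_nonneg_right (amountSold_le htT hq hcmax hπ ω) hω.le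

lemma admissible_const (F : Filtration ℝ≥0 mΩ) {k : ℝ} (hk : k ∈ Icc 0 cmax) :
    Admissible P F T cmax fun _ _ => k where
  progressive _ _ := stronglyMeasurable_const
  range _ _ _ := hk
  right_cont _ _ _ := continuousWithinAt_const
  sq_integrable := by
    simp only [energy, lintegral_const, measure_univ, mul_one, Measure.restrict_apply_univ,
      Real.volume_Icc]
    exact ENNReal.mul_lt_top (ENNReal.pow_lt_top enorm_lt_top) ENNReal.ofReal_lt_top

lemma IsRegularPrice.expectedPayoff_candidate (hB : IsPreBrownianReal W P) (htT : t ≤ T)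
    (hq : 0 < q) (hcmax : 0 ≤ cmax) (hX : IsRegularPrice P W hW t T x X) :
    expectedPayoff P t T q X (fun _ _ => candidateRate t T q cmax)
      = candidateValue t T x q cmax := by
  have hk := candidateRate_mem htT hq hcmax
  have hmul := candidateRate_mul (cmax := cmax) hq t T
  have hπ := admissible_const (P := P) (T := T) (augFiltration P W hW) hk
  rw [(hX.expectedPayoff_eq hB htT hq hπ).2]
  simp_rw [amountSold_const hq hk.1 (hmul.trans_le (min_le_left _ _))]
  rw [integral_const_mul, hX.integral_eq hB ⟨htT, le_rfl⟩, hmul, candidateValue_eq]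

end Payoff

/-! ### Passage to an indistinguishable price -/

section Transfer

variable {Ω : Type*} {t T : ℝ≥0} {q : ℝ} {X X' π : ℝ≥0 → Ω → ℝ}

/-- Payoffs along a path depend only on the price on `[t, T]`. -/
lemma payoff_congr (htT : t ≤ T) {ω : Ω} (h : ∀ r ∈ Icc t T, X' r ω = X r ω) :
    payoff t T q X' π ω = payoff t T q X π ω := by
  have h1 := start_le_liquidationTime (t := t) (T := T) (q := q) (π := π) (ω := ω) htT
  have h2 := liquidationTime_le (t := t) (T := T) (q := q) (π := π) (ω := ω)
  refine intervalIntegral.integral_congr fun s hs => ?_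
  rw [uIcc_of_le (NNReal.coe_le_coe.2 h1)] at hs
  have hs' : s.toNNReal ∈ Icc t T :=
    ⟨NNReal.le_toNNReal_of_coe_le hs.1, (Real.toNNReal_le_iff_le_coe.2 hs.2).trans h2⟩
  simp only [h _ hs']

variable [mΩ : MeasurableSpace Ω] {P : Measure Ω}

lemma expectedPayoff_congr (htT : t ≤ T) (h : ∀ᵐ ω ∂P, ∀ r ∈ Icc t T, X' r ω = X r ω) :
    expectedPayoff P t T q X' π = expectedPayoff P t T q X π :=
  integral_congr_ae (by filter_upwards [h] with ω hω using payoff_congr htT hω)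

end Transfer

/-! ### The standard maximum principle -/

section Adjoint

variable {Ω : Type*} [mΩ : MeasurableSpace Ω] {P : Measure Ω} {W : ℝ≥0 → Ω → ℝ} {t T : ℝ≥0}

lemma isItoIntegral_zero (F : Filtration ℝ≥0 mΩ) (a b : ℝ≥0) {I : Ω → ℝ} (hI : ∀ ω, I ω = 0) :
    IsItoIntegral P F W (fun _ _ => 0) a b I := by
  let Φ : SimpleProcess F :=
    { n := 0
      time := fun _ => 0
      time_mono := monotone_const
      coeff := fun _ _ => 0
      coeff_meas := fun _ => stronglyMeasurable_const
      coeff_bdd := ⟨0, by simp⟩ }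
  refine ⟨fun _ => Φ, ?_, ?_⟩
  · simp [Φ, SimpleProcess.value, energy]
  · simp [Φ, SimpleProcess.integral, hI]

lemma isContAdapted_of_deterministic (F : Filtration ℝ≥0 mΩ) {y : ℝ≥0 → ℝ} (hy : Continuous y) :
    IsContAdapted P F t T fun r _ => y r :=
  ⟨fun _ _ => stronglyMeasurable_const, ae_of_all _ fun _ => hy.continuousOn⟩

lemma deriv_stdHamiltonian_price (x q p yX yQ zX zQ : ℝ) :
    deriv (fun y => stdHamiltonian y q p yX yQ zX zQ) x = zX + p := by
  have h : HasDerivAt (fun y => stdHamiltonian y q p yX yQ zX zQ) (zX + p) x := by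
    have := ((((hasDerivAt_id x).mul_const zX).add_const (0 * zQ)).const_add
      (0 * yX + (-p) * yQ)).fun_add ((hasDerivAt_id x).const_mul p)
    simpa [stdHamiltonian, runningPayoff] using this
  exact h.deriv

lemma deriv_stdHamiltonian_inventory (x q p yX yQ zX zQ : ℝ) :
    deriv (fun y => stdHamiltonian x y p yX yQ zX zQ) q = 0 :=
  deriv_const q (stdHamiltonian x 0 p yX yQ zX zQ)

/-- Along a constant control the adjoint equations have a deterministic solution. -/
lemma exists_isStdAdjoint (F : Filtration ℝ≥0 mΩ) (q k : ℝ) (X : ℝ≥0 → Ω → ℝ) :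
    ∃ YX YQ ZX ZQ, IsStdAdjoint P F W t T q X (fun _ _ => k) YX YQ ZX ZQ := by
  -- With `Z = 0` the price driver `Z^X + k` is the constant `k`, which integrates to `k (T - r)`;
  -- the inventory driver is zero.
  refine ⟨fun r _ => k * ((T : ℝ) - r), fun _ _ => 0, fun _ _ => 0, fun _ _ => 0, ?_, ?_⟩
  · simp only [deriv_stdHamiltonian_price, zero_add]
    exact
      { toIsContAdapted := isContAdapted_of_deterministic F (by fun_prop)
        progressive := fun _ _ => stronglyMeasurable_const
        sq_integrable := by simp [energy]
        eqn := fun r _ => isItoIntegral_zero F r T fun ω => by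
          rw [timeIntegral_const, sub_self] }
  · simp only [deriv_stdHamiltonian_inventory]
    exact
      { toIsContAdapted := isContAdapted_of_deterministic F continuous_const
        progressive := fun _ _ => stronglyMeasurable_const
        sq_integrable := by simp [energy]
        eqn := fun r _ => isItoIntegral_zero F r T fun ω => by simp [timeIntegral] }

/-- A backward equation with zero driver has only the zero solution. -/
lemma IsBSDESolution.ae_eq_zero [IsFiniteMeasure P] {hW : ∀ s, Measurable (W s)}
    (hB : IsPreBrownianReal W P) {Y Z : ℝ≥0 → Ω → ℝ}
    (h : IsBSDESolution P (augFiltration P W hW) W t T (fun _ _ => 0) Y Z) {r : ℝ≥0}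
    (hr : r ∈ Icc t T) : ∀ᵐ ω ∂P, Y r ω = 0 := by
  have hYm := h.adapted r hr
  have hI := (h.eqn r hr).isItoLimit hB hr.2
    (h.progressive.stronglyMeasurable_timeRestrict r le_rfl).aestronglyMeasurable
    (aestronglyMeasurable_const.sub (stronglyMeasurable_of_augFiltration hYm).aestronglyMeasurable)
  have e : (fun ω => timeIntegral r T (fun _ => 0) - Y r ω) = -Y r := by
    ext ω
    simp [timeIntegral]
  rw [e] at hI
  have hY2 : MemLp (Y r) 2 P := by simpa using hI.memLp_integral.neg
  -- The variable `-Y_r` is an Itô integral over `(r, T]`, hence orthogonal to `F_r`; but `Y_r` is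
  -- itself `F_r`-measurable, so `E Y_r² = 0`.
  have h0 := hI.integral_mul_eq_zero hB (fun p hp => by simp [timeRestrict, not_lt.2 hp]) hYm hY2
  simp only [Pi.neg_apply, mul_neg, integral_neg, neg_eq_zero, ← pow_two] at h0
  have := (integral_eq_zero_iff_of_nonneg (fun ω => sq_nonneg _) hY2.integrable_sq).1 h0
  filter_upwards [this] with ω hω
  exact pow_eq_zero_iff two_ne_zero |>.1 hω

end Adjoint

end Liquidation

theorem proposition1 {Ω : Type*} [mΩ : MeasurableSpace Ω] (P : Measure Ω) [IsProbabilityMeasure P]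
    (W : ℝ≥0 → Ω → ℝ) (hW : ∀ s, Measurable (W s)) (hBM : IsBrownianReal W P)
    (t T : ℝ≥0) (htT : t ≤ T) (cmax : ℝ) (hcmax : 0 ≤ cmax)
    (x q : ℝ) (hx : 0 < x) (hq : 0 < q)
    (X : ℝ≥0 → Ω → ℝ) (hX : IsPriceProcess P (augFiltration P W hW) W t T x X)
    (c : ℝ≥0 → Ω → ℝ) (hc : c = fun _ _ => candidateRate t T q cmax) :
    -- the payoffs of admissible controls are well defined
    (∀ π, Admissible P (augFiltration P W hW) T cmax π →
      (∀ᵐ ω ∂P, IntervalIntegrable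
        (fun s : ℝ => runningPayoff (π s.toNNReal ω) (X s.toNNReal ω)) volume
        (t : ℝ) (liquidationTime t T q π ω : ℝ)) ∧
      Integrable (payoff t T q X π) P) ∧
    -- the constant strategy is optimal
    Admissible P (augFiltration P W hW) T cmax c ∧
    IsGreatest (expectedPayoff P t T q X '' {π | Admissible P (augFiltration P W hW) T cmax π})
      (expectedPayoff P t T q X c) ∧
    -- its value and the value function are given by the explicit formula
    expectedPayoff P t T q X c = candidateValue t T x q cmax ∧
    valueFunction P (augFiltration P W hW) t T q cmax X = candidateValue t T x q cmax ∧
    -- it violates the standard maximum principle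
    (q < cmax * ((T : ℝ) - t) →
      (∃ YX YQ ZX ZQ, IsStdAdjoint P (augFiltration P W hW) W t T q X c YX YQ ZX ZQ) ∧
      (∀ YX YQ ZX ZQ, IsStdAdjoint P (augFiltration P W hW) W t T q X c YX YQ ZX ZQ →
        ∀ r ∈ Icc t T, ∀ᵐ ω ∂P, ¬ StdMaximumCondition t q cmax X c YX YQ ZX ZQ r ω) ∧
      ∀ r ∈ Icc t T, ∀ᵐ ω ∂P,
        ¬ ∀ p ∈ Icc 0 cmax, runningPayoff p (X r ω) ≤ runningPayoff (c r ω) (X r ω)) := by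
  have hpre := hBM.toIsPreBrownianReal
  obtain ⟨X', hX', hXX⟩ := hX.exists_regular hpre htT
  have hrate := candidateRate_mem htT hq hcmax
  have hcadm : Admissible P (augFiltration P W hW) T cmax c := by
    rw [hc]
    exact admissible_const _ hrate
  have hpay (π : ℝ≥0 → Ω → ℝ) : expectedPayoff P t T q X' π = expectedPayoff P t T q X π :=
    expectedPayoff_congr htT hXX
  have hval : expectedPayoff P t T q X c = candidateValue t T x q cmax := by
    rw [← hpay, hc]
    exact hX'.expectedPayoff_candidate hpre htT hq hcmax
  have hgreatest : IsGreatest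
      (expectedPayoff P t T q X '' {π | Admissible P (augFiltration P W hW) T cmax π})
      (expectedPayoff P t T q X c) := by
    refine ⟨⟨c, hcadm, rfl⟩, ?_⟩
    rintro _ ⟨π, hπ, rfl⟩
    rw [hval, ← hpay]
    exact hX'.expectedPayoff_le hpre htT hq hx hcmax hπ
  have hpos (r : ℝ≥0) (hr : r ∈ Icc t T) : ∀ᵐ ω ∂P, 0 < X r ω := by
    filter_upwards [hXX, hX'.ae_pos hpre hx hr] with ω h1 h2
    rwa [← h1 r hr]
  refine ⟨fun π hπ => ⟨?_, ?_⟩, hcadm, hgreatest, hval, ?_, fun hlt => ⟨?_, ?_, ?_⟩⟩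
  · filter_upwards [hX.cont] with ω hω
    exact intervalIntegrable_path_mul (start_le_liquidationTime htT) liquidationTime_le
      (hπ.progressive.path ω) (fun r hr => hπ.range r hr ω)
      (hω.mono (Icc_subset_Icc_right liquidationTime_le))
  · refine (hX'.integrable_payoff htT hq hπ).congr ?_
    filter_upwards [hXX] with ω hω
    exact payoff_congr htT hω
  · rw [valueFunction, hgreatest.csSup_eq, hval]
  · rw [hc]
    exact exists_isStdAdjoint _ _ _ _
  all_goals
    -- The strict inequality `q < cmax (T - t)` with `q > 0` excludes `T = t` and puts the candidate
    -- rate strictly below `cmax`.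
    have hTt : (0 : ℝ) < T - t := by
      rcases (sub_nonneg.2 (NNReal.coe_le_coe.2 htT)).eq_or_lt with e | e
      · rw [← e, mul_zero] at hlt
        exact absurd hq hlt.not_gt
      · exact e
    have hk : candidateRate t T q cmax < cmax := by
      rw [candidateRate, if_pos hlt.le, div_lt_iff₀ hTt]
      exact hlt
  · intro YX YQ ZX ZQ hadj r hr
    have hstock := hadj.stock
    simp only [deriv_stdHamiltonian_inventory] at hstock
    filter_upwards [hpos r hr, hstock.ae_eq_zero hpre hr] with ω h1 h2 h3
    -- With `Y^Q_r = 0` and the `Z^X` term common to both sides, testing `p = cmax` would give `cmax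
    -- X_r ≤ c_r X_r`, contradicting `c_r < cmax` and `X_r > 0`.
    have h4 := h3 cmax ⟨hcmax, le_rfl⟩
    simp only [stdHamiltonian, runningPayoff, h2, hc] at h4
    nlinarith
  · intro r hr
    filter_upwards [hpos r hr] with ω h1 h3
    have h4 := h3 cmax ⟨hcmax, le_rfl⟩
    simp only [runningPayoff, hc] at h4
    nlinarith
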